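/- Let $K$ be an arbitrary field of characteristic $p>0$, let $P_n=K[x_1,\dots,x_n]$, and let $\mathcal D(P_n)\subseteq \mathrm{End}_K(P_n)$ be the ring of differential operators on $P_n$, i.e. the $K$-algebra generated by $x_1,\dots,x_n$ and the higher derivations $\partial_i^{[k]}=\partial_i^k/k!$. It carries the canonical filtration $F_i=\bigoplus_{|\alpha|+|\beta|\le i}Kx^\alpha\partial^{[\beta]}$, where $\partial^{[\beta]}=\partial_1^{[\beta_1]}\cdots\partial_n^{[\beta_n]}$. Modules are left modules. **Definitions.** For $f:\mathbb N\to\mathbb N$ put $\gamma(f)=\inf\{r\in\mathbb R: f(i)\le i^r \text{ for } i\gg0\}$. Let $A$ be a $K$-algebra with a finite dimensional filtration $\{A_i\}_{i\ge 0}$ (an ascending exhaustive chain of finite dimensional subspaces with $1\in A_0$ and $A_iA_j\subseteq A_{i+j}$). For a nonzero finitely generated $A$-module $M=AM_0$ with $\dim_K M_0<\infty$, put $\mathrm{Dim}(M)=\gamma(i\mapsto\dim_K A_iM_0)$, which does not depend on $M_0$; the holonomic number $h_A$ is the infimum of $\mathrm{Dim}(M)$ over all such $M$. A set $\mathcal C$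 of subalgebras of $A$ is a *holonomic set of subalgebras of degree $d$ with multiplicity $e$* (with $d\ge1$ a natural number and $e>0$ real) if $d=h_A$ and for every nonzero $A$-module $M$ there are a nonzero finite dimensional $K$-subspace $V\subseteq M$ and an algebra $C\in\mathcal C$ such that $$\dim_K\big((C\cap A_i)V\big)\ \ge\ \frac{e}{d!}\,i^d+o(i^d),\qquad i\gg0 .$$ For $S\subseteq\{1,\dots,n\}$ and integers $k_i\ge0$ ($i\notin S$), let $\Lambda_{S,k}=\bigotimes_{i\in S}K[x_i]\otimes\bigotimes_{i\notin S}\Lambda_i^{[p^{k_i}]}$ with $\Lambda_i^{[p^{k}]}=\bigoplus_{j\ge0}K\partial_i^{[jp^{k}]}$, that is, the subalgebra of $\mathcal D(P_n)$ generated by the $x_i$, $i\in S$, and the $\partial_i^{[jp^{k_i}]}$, $i\notin S$, $j\ge0$. These are the subalgebras of type $P_s\otimes\bigotimes_{i=1}^{n-s}\Lambda_{-1}^{[p^{k_i}]}$, $s=|S|$. For $\varepsilon\in\{\pm1\}^n$ let $\Lambda_\varepsilon=\Lambda_{\varepsilon_1}\otimes\cdots\otimes\Lambda_{\varepsilon_n}$,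 where $\Lambda_{\varepsilon_i}=K[x_i]$ if $\varepsilon_i=1$ and $\Lambda_{\varepsilon_i}=K[\partial_i^{[1]},\partial_i^{[2]},\dots]$ if $\varepsilon_i=-1$. **Theorem.** 1. If $n\ge1$, the set $\mathcal C=\{\Lambda_{S,k}\}$ of all subalgebras of type $P_s\otimes\bigotimes_{i=1}^{n-s}\Lambda_{-1}^{[p^{k_i}]}$, $0\le s\le n$, $k_i\ge0$, is a holonomic set of subalgebras of degree $n$ with multiplicity $1$ for $\mathcal D(P_n)$ with its canonical filtration. 2. If $n\ge1$, the set $\mathcal C'=\{\Lambda_\varepsilon:\varepsilon\in\{\pm1\}^n\}$ is a holonomic set of subalgebras of degree $n$ with multiplicity $1$ for $\mathcal D(P_n)$ with its canonical filtration. 3. For every nonzero $\mathcal D(P_n)$-module $M$ there are an algebra $\Lambda=\Lambda_{S,k}$ in $\mathcal C$ and a finite dimensional $K$-subspace $V\subseteq M$ such that $\dim_K V\ge p^{\sum_{i\notin S}k_i}$ and the natural map $\Lambda\otimes_K V\to\Lambda V$, $\lambda\otimes v\mapsto\lambda v$, is an isomorphism of $\Lambda$-modules. -/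

import Mathlib

universe u v w

/-! ### Growth, finite dimensional filtrations, holonomic sets of subalgebras -/

namespace HolSub

/-- The degree of growth `γ(f) = inf {r ∈ ℝ | f(i) ≤ i ^ r for i ≫ 0}`, an extended real number
(`⊤` if `f` is not of polynomial growth). -/
noncomputable def growthDegree (f : ℕ → ℕ) : EReal :=
  sInf {x : EReal | ∃ r : ℝ, x = (r : EReal) ∧
    ∀ᶠ i : ℕ in Filter.atTop, (f i : ℝ) ≤ (i : ℝ) ^ r}

/-- A finite dimensional filtration `A₀ ⊆ A₁ ⊆ ⋯` of a `K`-algebra `A`. -/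
structure FiniteFiltration (K : Type u) (A : Type v) [Field K] [Ring A] [Algebra K A] where
  /-- the `i`-th term of the filtration -/
  term : ℕ → Submodule K A
  mono : ∀ i j : ℕ, i ≤ j → term i ≤ term j
  exhaustive : ∀ a : A, ∃ i : ℕ, a ∈ term i
  one_mem : (1 : A) ∈ term 0
  mul_mem : ∀ (i j : ℕ) (a b : A), a ∈ term i → b ∈ term j → a * b ∈ term (i + j)
  finite : ∀ i : ℕ, FiniteDimensional K (term i)

section

variable {K : Type u} {A : Type v} [Field K] [Ring A] [Algebra K A]

/-- The subspace `U V` of an `A`-module `M` spanned by the products `a • v`, `a ∈ U`, `v ∈ V`. -/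
def actSpan {M : Type w} [AddCommGroup M] [Module K M] [Module A M]
    (U : Submodule K A) (V : Submodule K M) : Submodule K M :=
  Submodule.span K (Set.image2 (fun (a : A) (m : M) => a • m) (U : Set A) (V : Set M))

/-- The number `γ(i ↦ dim_K (A_i M₀))`. It is the dimension `Dim M` of the finitely generated
module `M` whenever `M₀` is a finite dimensional generating subspace, `M = A M₀`. -/
noncomputable def dimWith (F : FiniteFiltration K A) {M : Type w} [AddCommGroup M] [Module K M]
    [Module A M] (M₀ : Submodule K M) : EReal :=
  growthDegree (fun i : ℕ => Module.finrank K (actSpan (F.term i) M₀))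

/-- The holonomic number `h_A`: the infimum of `Dim M` over the nonzero finitely generated
`A`-modules `M = A M₀`. (Each such module is isomorphic to a quotient of some `A ^ m`, so that it
suffices to let `M` range over the universe of `A`.) -/
noncomputable def holonomicNumber (F : FiniteFiltration K A) : EReal :=
  sInf {x : EReal | ∃ (M : Type v) (_ : AddCommGroup M) (_ : Module K M) (_ : Module A M)
    (_ : IsScalarTower K A M) (M₀ : Submodule K M), Nontrivial M ∧ FiniteDimensional K M₀ ∧
      Submodule.span A (M₀ : Set M) = ⊤ ∧ x = dimWith F M₀}

/-- A set `C` of subalgebras of `A` is sub-holonomic of degree `d > 0` with leading coefficient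
`l > 0`: each nonzero `A`-module `M` has a nonzero finite dimensional subspace `V` such that
`dim_K (B_i V) ≥ l i ^ d + o(i ^ d)` for some `B ∈ C`, where `B_i = B ∩ A_i`. -/
def IsSubHolonomicSet (F : FiniteFiltration K A) (C : Set (Subalgebra K A)) (d l : ℝ) : Prop :=
  0 < d ∧ 0 < l ∧
    ∀ (M : Type w) [AddCommGroup M] [Module K M] [Module A M] [IsScalarTower K A M] [Nontrivial M],
      ∃ V : Submodule K M, V ≠ ⊥ ∧ FiniteDimensional K V ∧
        ∃ B ∈ C, ∃ r : ℕ → ℝ,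
          r =o[Filter.atTop] (fun i : ℕ => (i : ℝ) ^ d) ∧
          ∀ᶠ i : ℕ in Filter.atTop,
            l * (i : ℝ) ^ d + r i ≤
              (Module.finrank K (actSpan (Subalgebra.toSubmodule B ⊓ F.term i) V) : ℝ)

/-- A set `C` of subalgebras of `A` is a holonomic set of (natural) degree `d` and with
multiplicity `e`: it is sub-holonomic of degree `d` with leading coefficient `e / d!`, and `d` is
the holonomic number of `A`. -/
def IsHolonomicSet (F : FiniteFiltration K A) (C : Set (Subalgebra K A)) (d : ℕ) (e : ℝ) : Prop :=
  IsSubHolonomicSet.{u, v, w} F C (d : ℝ) (e / (d.factorial : ℝ)) ∧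
    holonomicNumber F = ((d : ℝ) : EReal)

end

/-! ### The ring of differential operators `D(P_n)` and its canonical filtration -/

variable (K : Type u) [Field K] (n : ℕ)

/-- Multiplication by the monomial `x ^ α` on `P_n = K[x₁, …, x_n]`. -/
noncomputable def mulMon (α : Fin n →₀ ℕ) : Module.End K (MvPolynomial (Fin n) K) :=
  LinearMap.mulLeft K (MvPolynomial.monomial α (1 : K))

/-- The divided power differential operator `∂ ^ [β] = ∂₁ ^ [β₁] ⋯ ∂_n ^ [β_n]` (formally
`∂ ^ β / β!`), that is, `x ^ γ ↦ ∏ i, (γ_i choose β_i) x ^ (γ - β)`. -/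
noncomputable def divDer (β : Fin n →₀ ℕ) : Module.End K (MvPolynomial (Fin n) K) :=
  (MvPolynomial.basisMonomials (Fin n) K).constr K
    (fun γ => MvPolynomial.monomial (γ - β) (∏ i, (((γ i).choose (β i) : ℕ) : K)))

/-- The ring `D(P_n)` of differential operators on `P_n`, as the subalgebra of `End_K(P_n)`
generated by `x₁, …, x_n` and by the higher derivations `∂_i ^ [k]`. -/
noncomputable def diffOps : Subalgebra K (Module.End K (MvPolynomial (Fin n) K)) :=
  Algebra.adjoin K
    ({T | ∃ i : Fin n, T = mulMon K n (Finsupp.single i 1)} ∪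
      {T | ∃ (i : Fin n) (k : ℕ), T = divDer K n (Finsupp.single i k)})

variable {K n}

theorem divDer_monomial (β γ : Fin n →₀ ℕ) (c : K) :
    divDer K n β (MvPolynomial.monomial γ c) =
      MvPolynomial.monomial (γ - β) (c * ∏ i, (((γ i).choose (β i) : ℕ) : K)) := by
  have h : (MvPolynomial.monomial γ c : MvPolynomial (Fin n) K) =
      c • (MvPolynomial.basisMonomials (Fin n) K) γ := by
    simp [MvPolynomial.smul_monomial]
  rw [h, map_smul, divDer, Module.Basis.constr_basis, MvPolynomial.smul_monomial, smul_eq_mul]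

theorem mulMon_monomial (α γ : Fin n →₀ ℕ) (c : K) :
    mulMon K n α (MvPolynomial.monomial γ c) = MvPolynomial.monomial (α + γ) c := by
  simp [mulMon, MvPolynomial.monomial_mul]

theorem end_ext {S T : Module.End K (MvPolynomial (Fin n) K)}
    (h : ∀ γ : Fin n →₀ ℕ,
      S (MvPolynomial.monomial γ 1) = T (MvPolynomial.monomial γ 1)) : S = T := by
  apply (MvPolynomial.basisMonomials (Fin n) K).ext
  intro γ
  simpa using h γ

theorem mulMon_mul (α β : Fin n →₀ ℕ) :
    mulMon K n α * mulMon K n β = mulMon K n (α + β) := by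
  apply end_ext
  intro γ
  simp [Module.End.mul_apply, mulMon_monomial, add_assoc]

theorem mulMon_zero : mulMon K n 0 = 1 := by
  apply end_ext
  intro γ
  simp [mulMon_monomial]

theorem divDer_zero : divDer K n 0 = 1 := by
  apply end_ext
  intro γ
  simp [divDer_monomial]

theorem divDer_mul (α β : Fin n →₀ ℕ) :
    divDer K n α * divDer K n β =
      (∏ i, (((α i + β i).choose (α i) : ℕ) : K)) • divDer K n (α + β) := by
  apply end_ext
  intro γ
  rw [Module.End.mul_apply, divDer_monomial, divDer_monomial, LinearMap.smul_apply,
    divDer_monomial, MvPolynomial.smul_monomial, tsub_tsub, add_comm β α, smul_eq_mul]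
  congr 1
  simp only [one_mul, ← Finset.prod_mul_distrib]
  refine Finset.prod_congr rfl fun i _ => ?_
  rw [← Nat.cast_mul, ← Nat.cast_mul]
  congr 1
  have h := Nat.choose_mul (n := γ i) (k := α i + β i) (s := β i) (Nat.le_add_left _ _)
  simp only [Finsupp.coe_tsub, Pi.sub_apply, Finsupp.coe_add, Pi.add_apply]
  rw [Nat.add_sub_cancel_right] at h
  rw [← h, mul_comm, Nat.choose_symm_add]

theorem mulMon_mem (α : Fin n →₀ ℕ) : mulMon K n α ∈ diffOps K n := by
  induction α using Finsupp.induction with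
  | zero => rw [mulMon_zero]; exact one_mem _
  | single_add i k f _ _ ih =>
    rw [← mulMon_mul]
    refine mul_mem ?_ ih
    clear * -
    induction k with
    | zero => rw [Finsupp.single_zero, mulMon_zero]; exact one_mem _
    | succ k ih =>
      rw [Finsupp.single_add, ← mulMon_mul]
      exact mul_mem ih (Algebra.subset_adjoin (Or.inl ⟨i, rfl⟩))

theorem divDer_single_add (i : Fin n) (k : ℕ) (f : Fin n →₀ ℕ) (hi : i ∉ f.support) :
    divDer K n (Finsupp.single i k + f) = divDer K n (Finsupp.single i k) * divDer K n f := by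
  rw [divDer_mul]
  have h : ∏ j, ((((Finsupp.single i k : Fin n →₀ ℕ) j + f j).choose
      ((Finsupp.single i k : Fin n →₀ ℕ) j) : ℕ) : K) = 1 := by
    refine Finset.prod_eq_one fun j _ => ?_
    by_cases hj : i = j
    · subst hj
      rw [Finsupp.notMem_support_iff.mp hi, add_zero, Nat.choose_self, Nat.cast_one]
    · simp [hj]
  rw [h, one_smul]

theorem divDer_mem (β : Fin n →₀ ℕ) : divDer K n β ∈ diffOps K n := by
  induction β using Finsupp.induction with
  | zero => rw [divDer_zero]; exact one_mem _
  | single_add i k f hi _ ih =>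
    rw [divDer_single_add i k f hi]
    exact mul_mem (Algebra.subset_adjoin (Or.inr ⟨i, k, rfl⟩)) ih

variable (K n) in
/-- The span of the operators `x ^ α ∂ ^ [β]` with `|α| + |β| ≤ i`. -/
noncomputable def canonicalSpan (i : ℕ) : Submodule K (Module.End K (MvPolynomial (Fin n) K)) :=
  Submodule.span K {T | ∃ α β : Fin n →₀ ℕ, α.degree + β.degree ≤ i ∧
    T = mulMon K n α * divDer K n β}

theorem canonicalSpan_mono {i j : ℕ} (h : i ≤ j) : canonicalSpan K n i ≤ canonicalSpan K n j := by
  refine Submodule.span_mono ?_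
  rintro T ⟨α, β, hab, rfl⟩
  exact ⟨α, β, hab.trans h, rfl⟩

theorem mem_canonicalSpan {i : ℕ} (α β : Fin n →₀ ℕ) (h : α.degree + β.degree ≤ i) :
    mulMon K n α * divDer K n β ∈ canonicalSpan K n i :=
  Submodule.subset_span ⟨α, β, h, rfl⟩

theorem divDer_single_mulMon (k : Fin n) (m : ℕ) (α : Fin n →₀ ℕ) :
    divDer K n (Finsupp.single k m) * mulMon K n α =
      ∑ a ∈ Finset.HasAntidiagonal.antidiagonal m, (((α k).choose a.1 : ℕ) : K) •
        (mulMon K n (α - Finsupp.single k a.1) * divDer K n (Finsupp.single k a.2)) := by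
  have key : ∀ (γ : Fin n →₀ ℕ) (b : ℕ),
      ∏ i, (((γ i).choose ((Finsupp.single k b : Fin n →₀ ℕ) i) : ℕ) : K) =
        (((γ k).choose b : ℕ) : K) := by
    intro γ b
    rw [Finset.prod_eq_single k]
    · simp
    · intro i _ hi
      simp [Ne.symm hi]
    · simp
  apply end_ext
  intro γ
  rw [Module.End.mul_apply, mulMon_monomial, divDer_monomial, key, one_mul, LinearMap.sum_apply]
  simp only [LinearMap.smul_apply, Module.End.mul_apply, divDer_monomial, mulMon_monomial, key,
    one_mul, MvPolynomial.smul_monomial, smul_eq_mul]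
  rw [Finsupp.add_apply, Nat.add_choose_eq, Nat.cast_sum, map_sum]
  refine Finset.sum_congr rfl fun a ha => ?_
  rw [Finset.HasAntidiagonal.mem_antidiagonal] at ha
  rw [Nat.cast_mul]
  by_cases h1 : a.1 ≤ α k
  · by_cases h2 : a.2 ≤ γ k
    · congr 2
      ext j
      by_cases hj : k = j
      · subst hj
        simp
        omega
      · simp [hj]
    · simp [Nat.choose_eq_zero_of_lt (not_le.mp h2)]
  · simp [Nat.choose_eq_zero_of_lt (not_le.mp h1)]

theorem divDer_single_mul_mem (k : Fin n) (m : ℕ) {j : ℕ}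
    {T : Module.End K (MvPolynomial (Fin n) K)} (hT : T ∈ canonicalSpan K n j) :
    divDer K n (Finsupp.single k m) * T ∈ canonicalSpan K n (m + j) := by
  induction hT using Submodule.span_induction with
  | zero => rw [mul_zero]; exact zero_mem _
  | add S T _ _ hS hT => rw [mul_add]; exact add_mem hS hT
  | smul c T _ hT => rw [mul_smul_comm]; exact Submodule.smul_mem _ _ hT
  | mem T hT =>
    obtain ⟨α, β, hab, rfl⟩ := hT
    rw [← mul_assoc, divDer_single_mulMon, Finset.sum_mul]
    refine Submodule.sum_mem _ fun a ha => ?_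
    rw [Finset.HasAntidiagonal.mem_antidiagonal] at ha
    rw [smul_mul_assoc, mul_assoc, divDer_mul, mul_smul_comm]
    refine Submodule.smul_mem _ _ (Submodule.smul_mem _ _ (mem_canonicalSpan _ _ ?_))
    have h1 : (α - Finsupp.single k a.1).degree ≤ α.degree :=
      Finsupp.degree_mono tsub_le_self
    rw [map_add, Finsupp.degree_single]
    omega

theorem divDer_mul_mem (β : Fin n →₀ ℕ) {j : ℕ}
    {T : Module.End K (MvPolynomial (Fin n) K)} (hT : T ∈ canonicalSpan K n j) :
    divDer K n β * T ∈ canonicalSpan K n (β.degree + j) := by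
  induction β using Finsupp.induction with
  | zero => simpa [divDer_zero] using hT
  | single_add i k f hi _ ih =>
    rw [divDer_single_add i k f hi, mul_assoc, map_add, Finsupp.degree_single, add_assoc]
    exact divDer_single_mul_mem i k ih

theorem mulMon_mul_mem (α : Fin n →₀ ℕ) {j : ℕ}
    {T : Module.End K (MvPolynomial (Fin n) K)} (hT : T ∈ canonicalSpan K n j) :
    mulMon K n α * T ∈ canonicalSpan K n (α.degree + j) := by
  induction hT using Submodule.span_induction with
  | zero => rw [mul_zero]; exact zero_mem _
  | add S T _ _ hS hT => rw [mul_add]; exact add_mem hS hT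
  | smul c T _ hT => rw [mul_smul_comm]; exact Submodule.smul_mem _ _ hT
  | mem T hT =>
    obtain ⟨α', β, hab, rfl⟩ := hT
    rw [← mul_assoc, mulMon_mul]
    refine mem_canonicalSpan _ _ ?_
    rw [map_add]
    omega

theorem canonicalSpan_mul_mem {i j : ℕ} {S T : Module.End K (MvPolynomial (Fin n) K)}
    (hS : S ∈ canonicalSpan K n i) (hT : T ∈ canonicalSpan K n j) :
    S * T ∈ canonicalSpan K n (i + j) := by
  induction hS using Submodule.span_induction with
  | zero => rw [zero_mul]; exact zero_mem _
  | add S S' _ _ hS hS' => rw [add_mul]; exact add_mem hS hS'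
  | smul c S _ hS => rw [smul_mul_assoc]; exact Submodule.smul_mem _ _ hS
  | mem S hS =>
    obtain ⟨α, β, hab, rfl⟩ := hS
    rw [mul_assoc]
    refine canonicalSpan_mono ?_ (mulMon_mul_mem α (divDer_mul_mem β hT))
    omega

theorem canonicalSpan_one_mem : (1 : Module.End K (MvPolynomial (Fin n) K)) ∈
    canonicalSpan K n 0 := by
  have h := mem_canonicalSpan (K := K) (n := n) (i := 0) 0 0 (by simp)
  rwa [mulMon_zero, divDer_zero, one_mul] at h

theorem canonicalSpan_exhaustive {T : Module.End K (MvPolynomial (Fin n) K)}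
    (hT : T ∈ diffOps K n) : ∃ i : ℕ, T ∈ canonicalSpan K n i := by
  induction hT using Algebra.adjoin_induction with
  | mem T hT =>
    rcases hT with ⟨i, rfl⟩ | ⟨i, k, rfl⟩
    · have h := mem_canonicalSpan (K := K) (Finsupp.single i 1) 0 le_rfl
      rw [divDer_zero, mul_one] at h
      exact ⟨_, h⟩
    · have h := mem_canonicalSpan (K := K) 0 (Finsupp.single i k) le_rfl
      rw [mulMon_zero, one_mul] at h
      exact ⟨_, h⟩
  | algebraMap c =>
    refine ⟨0, ?_⟩
    rw [Algebra.algebraMap_eq_smul_one]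
    exact Submodule.smul_mem _ _ canonicalSpan_one_mem
  | add S T _ _ hS hT =>
    obtain ⟨i, hi⟩ := hS
    obtain ⟨j, hj⟩ := hT
    exact ⟨max i j, add_mem (canonicalSpan_mono (le_max_left i j) hi)
      (canonicalSpan_mono (le_max_right i j) hj)⟩
  | mul S T _ _ hS hT =>
    obtain ⟨i, hi⟩ := hS
    obtain ⟨j, hj⟩ := hT
    exact ⟨i + j, canonicalSpan_mul_mem hi hj⟩

theorem canonicalSpan_finite (i : ℕ) : FiniteDimensional K (canonicalSpan K n i) := by
  refine FiniteDimensional.span_of_finite K ?_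
  have hfin : {α : Fin n →₀ ℕ | α.degree ≤ i}.Finite := Finsupp.finite_of_degree_le i
  refine (Set.Finite.image2 (fun α β => mulMon K n α * divDer K n β) hfin hfin).subset ?_
  rintro T ⟨α, β, hab, rfl⟩
  exact ⟨α, (Nat.le_add_right _ _).trans hab, β, (Nat.le_add_left _ _).trans hab, rfl⟩

variable (K n)

/-- The canonical filtration `F_i = ⨁_{|α| + |β| ≤ i} K x ^ α ∂ ^ [β]` of `D(P_n)`. -/
noncomputable def canonicalFiltration : FiniteFiltration K (diffOps K n) where
  term i := (canonicalSpan K n i).comap (diffOps K n).val.toLinearMap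
  mono i j h := Submodule.comap_mono (canonicalSpan_mono h)
  exhaustive a := canonicalSpan_exhaustive a.2
  one_mem := canonicalSpan_one_mem
  mul_mem _ _ _ _ ha hb := canonicalSpan_mul_mem ha hb
  finite i := by
    have := canonicalSpan_finite (K := K) (n := n) i
    have hinj : Function.Injective (diffOps K n).val.toLinearMap := Subtype.val_injective
    let f : (canonicalSpan K n i).comap (diffOps K n).val.toLinearMap →ₗ[K]
        canonicalSpan K n i :=
      LinearMap.restrict (diffOps K n).val.toLinearMap (fun _ h => h)
    have hf : Function.Injective f := fun a b h => Subtype.ext (hinj (congrArg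
      (fun c : canonicalSpan K n i => (c : Module.End K (MvPolynomial (Fin n) K))) h))
    have : IsNoetherian K (canonicalSpan K n i) :=
      (IsNoetherian.iff_fg (K := K) (V := canonicalSpan K n i)).2 this
    exact Module.Finite.of_injective f hf

/-- The element `x_i` of `D(P_n)`. -/
noncomputable def xOp (i : Fin n) : diffOps K n := ⟨mulMon K n (Finsupp.single i 1), mulMon_mem _⟩

/-- The element `∂_i ^ [k]` of `D(P_n)`. -/
noncomputable def dOp (i : Fin n) (k : ℕ) : diffOps K n :=
  ⟨divDer K n (Finsupp.single i k), divDer_mem _⟩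

/-! ### The subalgebras -/

/-- The subalgebra of `D(P_n) = D(K[x₁]) ⊗ ⋯ ⊗ D(K[x_n])` which is the tensor product of the
subalgebras `K[x_i]`, `i ∈ S`, and `Λ_{-1} ^ [p ^ k_i] = ⨁_j K ∂_i ^ [j p ^ k_i]`, `i ∉ S`.
(The values of `k` on `S` play no role.) -/
noncomputable def typeSubalgebra (p : ℕ) (S : Finset (Fin n)) (k : Fin n → ℕ) :
    Subalgebra K (diffOps K n) :=
  Algebra.adjoin K
    ({T | ∃ i ∈ S, T = xOp K n i} ∪
      {T | ∃ i, i ∉ S ∧ ∃ j : ℕ, T = dOp K n i (j * p ^ k i)})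

/-- The set of all subalgebras of `D(P_n)` of type `P_s ⊗ ⨂_{i = 1}^{n - s} Λ_{-1} ^ [p ^ k_i]`,
`0 ≤ s ≤ n`, `k_i ≥ 0`: the `s` tensor factors equal to `K[x_i]` may stand at any places. -/
def typeSubalgebras (p : ℕ) : Set (Subalgebra K (diffOps K n)) :=
  {B | ∃ (S : Finset (Fin n)) (k : Fin n → ℕ), B = typeSubalgebra K n p S k}

/-- The subalgebra `Λ_ε = Λ_{ε₁} ⊗ ⋯ ⊗ Λ_{ε_n}` of `D(P_n)`, where `Λ_{ε_i} = K[x_i]` if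
`ε_i = 1`, and `Λ_{ε_i} = K[∂_i ^ [1], ∂_i ^ [2], …]` if `ε_i = -1`. -/
noncomputable def signSubalgebra (ε : Fin n → ℤˣ) : Subalgebra K (diffOps K n) :=
  Algebra.adjoin K
    ({T | ∃ i, ε i = 1 ∧ T = xOp K n i} ∪
      {T | ∃ i, ε i = -1 ∧ ∃ j : ℕ, T = dOp K n i j})

/-- The set `{Λ_ε | ε ∈ {±1} ^ n}`. -/
def signSubalgebras : Set (Subalgebra K (diffOps K n)) :=
  Set.range (signSubalgebra K n)

/-- A subalgebra `Λ` of `A` acts freely on a subspace `V` of an `A`-module `M`: the natural map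
`Λ ⊗ V → Λ V`, `a ⊗ v ↦ a v`, is an isomorphism of `Λ`-modules. -/
def ActsFreely {K : Type u} {A : Type v} [Field K] [Ring A] [Algebra K A] {M : Type w}
    [AddCommGroup M] [Module K M] [Module A M] [IsScalarTower K A M]
    (B : Subalgebra K A) (V : Submodule K M) : Prop :=
  ∃ e : TensorProduct K B V ≃ₗ[B] Submodule.span B (V : Set M),
    ∀ (b : B) (m : V), (e (TensorProduct.tmul K b m) : M) = (b : A) • (m : M)

end HolSub

/-! `P_n` is Noetherian, so a nonzero `M` contains some `v` whose annihilator `I` in `P_n` is prime;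
then `W = P_n v ≅ P_n / I` is torsion-free over a domain. Order the variables and let `S` consist of
those `i` for which `x_i` is transcendental modulo `I` over the preceding variables. For `i ∉ S`
take an algebraic relation of least degree, drop its coefficients lying in `I`, and write it as a
polynomial in `x_i ^ q`, `q = p ^ k_i`, with `k_i` maximal. The resulting `Q ∈ I` satisfies `∂_i ^
[a] Q = 0` unless `q ∣ a`, while `∂_i ^ [q] Q ∉ I`: this derivative has smaller degree and, by
Lucas, a coefficient outside `I` (`exists_separable_in_primePow`).

Such a `Q` detects the order in `∂_i`. Since `Q` kills `W`, the Leibniz formula turns `Q ∂_i ^ [b q]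
y` into terms `∂_i ^ [c q] (…)` with `c < b`, the top one being `± ∂_i ^ [(b - 1) q] ((∂_i ^ [q] Q)
y)`. Multiplying a relation by `Q` therefore shortens it, and `∂_i ^ [q] Q` is injective on `W`.
Treating the indices off `S` one by one shows that the `∂ ^ [p ^ k β]` act freely on `W`
(`eq_zero_of_sum_derOp_smul_eq_zero`).

Let `V` be spanned by the `x ^ δ v` with `δ` supported off `S` and `δ_i < p ^ k_i`. As `x_i`, `i ∉
S`, has degree at least `p ^ k_i` over the preceding variables, monomials with arbitrary exponents
on `S` and such bounded exponents off `S` are independent modulo `I`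
(`eq_zero_of_mem_of_degree_lt`). Hence `dim V = p ^ ∑ k_i` and `Λ_{S,k}` acts freely on `V`
(`exists_free_subspace`), which is the third claim.

For growth, allowing only multiples of `p ^ k_i` as orders loses at most the factor `∏ p ^ k_i` in
the count of operators, and `dim V` repays it; so the dimension is at least `N ^ n / n!` for every
`N`. This also gives `n ≤ h_A`, and the module `P_n` gives `h_A ≤ n`. The second claim follows from
`Λ_{S,k} ⊆ Λ_ε`. -/

namespace HolSub

/-- For a prime `p`, `(p ^ k * b).choose (p ^ k) ≡ b` modulo `p`. -/
theorem choose_primePow_mul_modEq {p : ℕ} (hp : p.Prime) (k b : ℕ) :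
    (p ^ k * b).choose (p ^ k) ≡ b [MOD p] := by
  have := Fact.mk hp
  induction k with
  | zero => simp [Nat.ModEq]
  | succ k ih =>
    have h := Choose.choose_modEq_choose_mod_mul_choose_div_nat (p := p)
      (n := p ^ (k + 1) * b) (k := p ^ (k + 1))
    have e1 : p ^ (k + 1) * b = p * (p ^ k * b) := by ring
    have e2 : p ^ (k + 1) = p * p ^ k := by ring
    rw [e1, e2] at h ⊢
    rw [Nat.mul_mod_right, Nat.mul_mod_right, Nat.mul_div_cancel_left _ hp.pos,
      Nat.mul_div_cancel_left _ hp.pos, Nat.choose_self, one_mul] at h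
    exact h.trans ih

/-! ### Minimal algebraic relations modulo a prime ideal -/

section Selection

open Polynomial

variable {K R P : Type*} [Field K] [CommRing R] [CommRing P] [Algebra K P] [Algebra R P]

/-- Dichotomy for an element `x` of a `K`-algebra `P` over a subring `R`, modulo a prime ideal `I`,
in characteristic `p`: either `x` is transcendental over `R` modulo `I`, or it is a root modulo `I`
of a polynomial in `X ^ p ^ k` which is separable as a polynomial in `X ^ p ^ k`, and its degree
over `R` modulo `I` is at least `p ^ k`. -/
theorem exists_separable_in_primePow {p : ℕ} (hp : p.Prime) [CharP K p] (I : Ideal P) [I.IsPrime]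
    (x : P) (h : ¬ ∀ G : R[X], aeval x G ∈ I → ∀ a, algebraMap R P (G.coeff a) ∈ I) :
    ∃ (k : ℕ) (G : R[X]), (∀ a, ¬ p ^ k ∣ a → G.coeff a = 0) ∧ aeval x G ∈ I ∧
      aeval x (hasseDeriv (p ^ k) G) ∉ I ∧
      ∀ H : R[X], (∀ a, p ^ k ≤ a → H.coeff a = 0) → aeval x H ∈ I →
        ∀ a, algebraMap R P (H.coeff a) ∈ I := by
  classical
  -- Pick a relation of least degree among those not trivial modulo `I`; `hmin` below is the
  -- resulting minimality.
  have hex : ∃ d : ℕ, ∃ G : R[X], G.natDegree = d ∧ aeval x G ∈ I ∧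
      ∃ a, algebraMap R P (G.coeff a) ∉ I := by
    push Not at h
    obtain ⟨G, h1, h2⟩ := h
    exact ⟨_, G, rfl, h1, h2⟩
  obtain ⟨G, hdeg, hG, hbad⟩ := Nat.find_spec hex
  have hmin : ∀ H : R[X], H.natDegree < G.natDegree → aeval x H ∈ I →
      ∀ a, algebraMap R P (H.coeff a) ∈ I := by
    intro H hH hHI a
    by_contra ha
    rw [hdeg] at hH
    exact Nat.find_min hex hH ⟨H, rfl, hHI, a, ha⟩
  -- discard the coefficients that lie in `I`
  let G' : R[X] := ∑ a ∈ G.support with algebraMap R P (G.coeff a) ∉ I, monomial a (G.coeff a)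
  have hcoeff : ∀ a, G'.coeff a = if algebraMap R P (G.coeff a) ∉ I then G.coeff a else 0 := by
    intro a
    simp only [G', finsetSum_coeff, coeff_monomial, Finset.sum_ite_eq', Finset.mem_filter,
      mem_support_iff]
    by_cases h0 : G.coeff a = 0
    · simp [h0]
    · simp [h0]
  have hG'I : aeval x G' ∈ I := by
    have h1 : aeval x (G - G') ∈ I := by
      rw [aeval_eq_sum_range]
      refine Ideal.sum_mem _ fun a _ => ?_
      rw [Algebra.smul_def]
      refine Ideal.mul_mem_right _ _ ?_
      rw [coeff_sub, hcoeff]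
      split_ifs with hc
      · simpa using hc
      · simp
    rw [map_sub] at h1
    simpa only [sub_sub_cancel] using I.sub_mem hG h1
  have hdeg' : G'.natDegree ≤ G.natDegree := by
    rw [natDegree_le_iff_coeff_eq_zero]
    intro a ha
    rw [hcoeff, coeff_eq_zero_of_natDegree_lt ha, ite_self]
  have hnot : ∀ a, G'.coeff a ≠ 0 → algebraMap R P (G'.coeff a) ∉ I := by
    intro a ha
    rw [hcoeff] at ha ⊢
    split_ifs at ha ⊢ with hc
    · exact absurd rfl ha
    · exact hc
  obtain ⟨a₁, ha₁⟩ := hbad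
  have ha₁' : G'.coeff a₁ ≠ 0 := by
    rw [hcoeff, if_pos ha₁]
    intro h0
    exact ha₁ (by simp [h0])
  -- some exponent is positive
  obtain ⟨a₀, ha₀, ha₀pos⟩ : ∃ a, G'.coeff a ≠ 0 ∧ 0 < a := by
    by_contra hcon
    push Not at hcon
    have hC : G' = C (G'.coeff 0) := by
      ext a
      rw [coeff_C]
      split_ifs with h0
      · rw [h0]
      · by_contra h1
        exact h0 (Nat.le_zero.mp (hcon a h1))
    have : a₁ = 0 := Nat.le_zero.mp (hcon a₁ ha₁')
    subst this
    rw [hC, aeval_C] at hG'I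
    exact hnot 0 ha₁' hG'I
  -- The least such power exists because `0 < a₀ < p ^ a₀`, and it is not the zeroth. Its
  -- predecessor `k` makes `p ^ k` the largest power of `p` dividing all exponents that occur.
  have hexk : ∃ k, ∃ a, G'.coeff a ≠ 0 ∧ ¬ p ^ k ∣ a := by
    refine ⟨a₀, a₀, ha₀, fun hd => ?_⟩
    exact absurd (Nat.le_of_dvd ha₀pos hd) (not_le.mpr (Nat.lt_pow_self hp.one_lt))
  obtain ⟨a, ha, hnd⟩ := Nat.find_spec hexk
  have hk0 : Nat.find hexk ≠ 0 := by
    intro h0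
    rw [h0] at hnd
    simp at hnd
  obtain ⟨k, hk⟩ := Nat.exists_eq_succ_of_ne_zero hk0
  rw [hk] at hnd
  have hdvd : ∀ a, G'.coeff a ≠ 0 → p ^ k ∣ a := by
    intro c hc
    by_contra hcd
    exact Nat.find_min hexk (by rw [hk]; exact Nat.lt_succ_self k) ⟨c, hc, hcd⟩
  obtain ⟨b, rfl⟩ := hdvd a ha
  have hpb : ¬ p ∣ b := by
    rintro ⟨c, rfl⟩
    exact hnd ⟨c, by rw [Nat.succ_eq_add_one]; ring⟩
  have hb0 : b ≠ 0 := by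
    rintro rfl
    exact hpb (dvd_zero p)
  have hle : p ^ k * 1 ≤ p ^ k * b := Nat.mul_le_mul_left _ (Nat.one_le_iff_ne_zero.mpr hb0)
  have hle' : p ^ k ≤ G.natDegree := by
    have := le_natDegree_of_ne_zero ha
    omega
  refine ⟨k, G', ?_, hG'I, ?_, ?_⟩
  · intro c hc
    by_contra h1
    exact hc (hdvd c h1)
  · intro hI
    -- The derivative has degree below that of `G`, so if its value were in `I`, all its
    -- coefficients would be. The one coming from `X ^ (p ^ k * b)` is that coefficient times a
    -- binomial congruent to `b`, a unit since `p ∤ b`.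
    have h1 := hmin (hasseDeriv (p ^ k) G') (by
      have := natDegree_hasseDeriv_le G' (p ^ k)
      have := Nat.pow_pos (n := k) hp.pos
      omega) hI (p ^ k * b - p ^ k)
    rw [hasseDeriv_coeff, Nat.sub_add_cancel (by omega), map_mul, map_natCast] at h1
    rcases (inferInstance : I.IsPrime).mem_or_mem h1 with h2 | h2
    · have h3 : (((p ^ k * b).choose (p ^ k) : ℕ) : K) ≠ 0 := by
        rw [Ne, CharP.cast_eq_zero_iff K p, (choose_primePow_mul_modEq hp k b).dvd_iff dvd_rfl]
        exact hpb
      refine (inferInstance : I.IsPrime).ne_top (Ideal.eq_top_of_isUnit_mem _ h2 ?_)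
      rw [← map_natCast (algebraMap K P)]
      exact (IsUnit.mk0 _ h3).map _
    · exact hnot _ ha h2
  · intro H hH hHI c
    by_contra hc
    have hlt : H.natDegree < p ^ k := by
      by_contra hcon
      have h0 := hH H.natDegree (not_lt.mp hcon)
      rw [coeff_natDegree, leadingCoeff_eq_zero] at h0
      rw [h0] at hc
      simp at hc
    exact hc (hmin H (hlt.trans_le hle') hHI c)

end Selection

/-! ### Leibniz formulas and commutation in `D(P_n)` -/

section Operators

open MvPolynomial

variable {K : Type u} [Field K] {n : ℕ}

theorem mulLeft_monomial (γ : Fin n →₀ ℕ) (c : K) :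
    LinearMap.mulLeft K (monomial γ c) = c • mulMon K n γ := by
  refine LinearMap.ext fun g => ?_
  rw [LinearMap.mulLeft_apply, mulMon, LinearMap.smul_apply, LinearMap.mulLeft_apply,
    ← smul_mul_assoc, smul_monomial, smul_eq_mul, mul_one]

theorem mulLeft_add_left (f g : MvPolynomial (Fin n) K) :
    LinearMap.mulLeft K (f + g) = LinearMap.mulLeft K f + LinearMap.mulLeft K g :=
  LinearMap.ext fun h => add_mul f g h

theorem mulLeft_mem_diffOps (f : MvPolynomial (Fin n) K) :
    LinearMap.mulLeft K f ∈ diffOps K n := by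
  induction f using MvPolynomial.induction_on' with
  | monomial γ c =>
    rw [mulLeft_monomial]
    exact Subalgebra.smul_mem _ (mulMon_mem γ) c
  | add f g hf hg =>
    rw [mulLeft_add_left]
    exact add_mem hf hg

variable (K n) in
/-- Multiplication by a polynomial, as an element of `D(P_n)`. -/
noncomputable def polyOp : MvPolynomial (Fin n) K →ₐ[K] diffOps K n :=
  (Algebra.lmul K (MvPolynomial (Fin n) K)).codRestrict (diffOps K n) mulLeft_mem_diffOps

variable (K) in
/-- The divided power differential operator `∂ ^ [β]`, as an element of `D(P_n)`. -/
noncomputable def derOp (β : Fin n →₀ ℕ) : diffOps K n := ⟨divDer K n β, divDer_mem β⟩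

theorem polyOp_X (i : Fin n) : polyOp K n (X i) = xOp K n i := rfl

theorem derOp_single (i : Fin n) (k : ℕ) : derOp K (Finsupp.single i k) = dOp K n i k := rfl

theorem derOp_zero : derOp K (0 : Fin n →₀ ℕ) = 1 := Subtype.ext divDer_zero

theorem derOp_mul (α β : Fin n →₀ ℕ) :
    derOp K α * derOp K β =
      (∏ i, (((α i + β i).choose (α i) : ℕ) : K)) • derOp K (α + β) :=
  Subtype.ext (divDer_mul α β)

theorem derOp_single_add (i : Fin n) (k : ℕ) (f : Fin n →₀ ℕ) (hi : i ∉ f.support) :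
    derOp K (Finsupp.single i k + f) = derOp K (Finsupp.single i k) * derOp K f :=
  Subtype.ext (divDer_single_add i k f hi)

theorem divDer_single_monomial (i : Fin n) (m : ℕ) (γ : Fin n →₀ ℕ) (c : K) :
    divDer K n (Finsupp.single i m) (monomial γ c) =
      monomial (γ - Finsupp.single i m) (c * ((γ i).choose m : ℕ)) := by
  rw [divDer_monomial, Finset.prod_eq_single i]
  · simp
  · intro j _ hj
    simp [Ne.symm hj]
  · simp

/-- The Leibniz formula for `∂_i ^ [m]`. -/
theorem divDer_single_mulLeft (i : Fin n) (m : ℕ) (f : MvPolynomial (Fin n) K) :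
    divDer K n (Finsupp.single i m) * LinearMap.mulLeft K f =
      ∑ a ∈ Finset.HasAntidiagonal.antidiagonal m,
        LinearMap.mulLeft K (divDer K n (Finsupp.single i a.1) f) *
          divDer K n (Finsupp.single i a.2) := by
  induction f using MvPolynomial.induction_on' with
  | monomial γ c =>
    rw [mulLeft_monomial, mul_smul_comm, divDer_single_mulMon, Finset.smul_sum]
    refine Finset.sum_congr rfl fun a _ => ?_
    rw [divDer_single_monomial, mulLeft_monomial, smul_smul, smul_mul_assoc]
  | add f g hf hg =>
    simp only [mulLeft_add_left, mul_add, hf, hg, map_add, add_mul, Finset.sum_add_distrib]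

theorem dOp_mul_polyOp (i : Fin n) (m : ℕ) (f : MvPolynomial (Fin n) K) :
    dOp K n i m * polyOp K n f =
      ∑ a ∈ Finset.HasAntidiagonal.antidiagonal m,
        polyOp K n (divDer K n (Finsupp.single i a.1) f) * dOp K n i a.2 := by
  apply Subtype.ext
  rw [AddSubmonoidClass.coe_finsetSum]
  exact divDer_single_mulLeft i m f

theorem divDer_single_comp (i : Fin n) (a b : ℕ) (f : MvPolynomial (Fin n) K) :
    divDer K n (Finsupp.single i a) (divDer K n (Finsupp.single i b) f) =
      ((a + b).choose a : K) • divDer K n (Finsupp.single i (a + b)) f := by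
  rw [← Module.End.mul_apply, divDer_mul, ← Finsupp.single_add, LinearMap.smul_apply,
    Finset.prod_eq_single i]
  · simp
  · intro j _ hj
    simp [Ne.symm hj]
  · simp

/-- The Leibniz formula for `∂_i ^ [m]`, with the coefficients on the right. -/
theorem polyOp_mul_dOp (i : Fin n) (m : ℕ) (f : MvPolynomial (Fin n) K) :
    polyOp K n f * dOp K n i m =
      ∑ a ∈ Finset.HasAntidiagonal.antidiagonal m,
        (-1 : K) ^ a.1 • (dOp K n i a.2 * polyOp K n (divDer K n (Finsupp.single i a.1) f)) := by
  -- Expand each summand by the left Leibniz formula and group by the total order of differentiation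
  -- falling on `f`; the coefficients become alternating binomial sums.
  have hassoc : ∑ a ∈ Finset.HasAntidiagonal.antidiagonal m, (-1 : K) ^ a.1 •
        (dOp K n i a.2 * polyOp K n (divDer K n (Finsupp.single i a.1) f)) =
      ∑ a ∈ Finset.HasAntidiagonal.antidiagonal m,
        ∑ b ∈ Finset.HasAntidiagonal.antidiagonal a.1, ((-1 : K) ^ b.1 * ((a.1).choose b.1 : K)) •
          (polyOp K n (divDer K n (Finsupp.single i a.1) f) * dOp K n i a.2) := by
    simp only [dOp_mul_polyOp, divDer_single_comp, map_smul, smul_mul_assoc, Finset.smul_sum,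
      smul_smul]
    rw [Finset.sum_sigma', Finset.sum_sigma']
    refine Finset.sum_bij' (fun s _ => ⟨(s.1.1 + s.2.1, s.2.2), (s.1.1, s.2.1)⟩)
      (fun s _ => ⟨(s.2.1, s.2.2 + s.1.2), (s.2.2, s.1.2)⟩) ?_ ?_ ?_ ?_ ?_
    · rintro ⟨⟨a, b⟩, ⟨c, d⟩⟩ h
      simp only [Finset.mem_sigma, Finset.HasAntidiagonal.mem_antidiagonal, and_true] at h ⊢
      omega
    · rintro ⟨⟨a, b⟩, ⟨c, d⟩⟩ h
      simp only [Finset.mem_sigma, Finset.HasAntidiagonal.mem_antidiagonal, and_true] at h ⊢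
      omega
    · rintro ⟨⟨a, b⟩, ⟨c, d⟩⟩ h
      simp only [Finset.mem_sigma, Finset.HasAntidiagonal.mem_antidiagonal] at h
      obtain ⟨h1, h2⟩ := h
      subst h2
      rfl
    · rintro ⟨⟨a, b⟩, ⟨c, d⟩⟩ h
      simp only [Finset.mem_sigma, Finset.HasAntidiagonal.mem_antidiagonal] at h
      obtain ⟨h1, h2⟩ := h
      subst h2
      rfl
    · rintro ⟨⟨a, b⟩, ⟨c, d⟩⟩ h
      simp only
      rw [add_comm c a, Nat.choose_symm_add]
  -- An alternating sum of binomials vanishes unless its order is zero, so only the term without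
  -- derivatives of `f` survives.
  rw [hassoc, Finset.sum_eq_single (0, m)]
  · simp [show (Finsupp.single i 0 : Fin n →₀ ℕ) = 0 by simp, divDer_zero]
  · rintro ⟨a, b⟩ hab hne
    rw [← Finset.sum_smul]
    have ha : a ≠ 0 := by
      rintro rfl
      simp at hab
      exact hne (by rw [hab])
    have h := Int.alternating_sum_range_choose_of_ne ha
    have h2 : ∑ b ∈ Finset.HasAntidiagonal.antidiagonal a, ((-1 : K) ^ b.1 * (a.choose b.1 : K)) =
        ((∑ b ∈ Finset.range (a + 1), (-1 : ℤ) ^ b * (a.choose b : ℤ) : ℤ) : K) := by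
      rw [Finset.Nat.sum_antidiagonal_eq_sum_range_succ_mk]
      push_cast
      rfl
    rw [h2, h, Int.cast_zero, zero_smul]
  · intro h
    simp at h

/-- A polynomial in which `x_i` does not occur is annihilated by `∂_i ^ [m]`, `m > 0`. -/
theorem divDer_single_eq_zero {i : Fin n} {s : Set (Fin n)} (hi : i ∉ s) {m : ℕ} (hm : m ≠ 0)
    {f : MvPolynomial (Fin n) K} (hf : f ∈ supported K s) :
    divDer K n (Finsupp.single i m) f = 0 := by
  rw [f.as_sum, map_sum]
  refine Finset.sum_eq_zero fun γ hγ => ?_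
  have h0 : γ i = 0 := by
    by_contra h0
    exact hi (mem_supported.mp hf (by
      rw [Finset.mem_coe, mem_vars_iff_mem_support]
      exact ⟨γ, hγ, Finsupp.mem_support_iff.mpr h0⟩))
  rw [divDer_single_monomial, h0, Nat.choose_eq_zero_of_lt (Nat.pos_of_ne_zero hm)]
  simp

/-- Every derivative of positive order of `f` vanishes, so one term of the Leibniz formula remains.
-/
theorem dOp_commute_polyOp {i : Fin n} {s : Set (Fin n)} (hi : i ∉ s) (m : ℕ)
    {f : MvPolynomial (Fin n) K} (hf : f ∈ supported K s) :
    dOp K n i m * polyOp K n f = polyOp K n f * dOp K n i m := by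
  rw [dOp_mul_polyOp, Finset.sum_eq_single (0, m)]
  · simp [show (Finsupp.single i 0 : Fin n →₀ ℕ) = 0 by simp, divDer_zero]
  · rintro ⟨a, b⟩ hab hne
    rw [divDer_single_eq_zero hi _ hf, map_zero, zero_mul]
    rintro rfl
    simp at hab
    exact hne (by rw [hab])
  · intro h
    simp at h

theorem derOp_commute_polyOp {s : Set (Fin n)} {β : Fin n →₀ ℕ} (hβ : ∀ i ∈ β.support, i ∉ s)
    {f : MvPolynomial (Fin n) K} (hf : f ∈ supported K s) :
    derOp K β * polyOp K n f = polyOp K n f * derOp K β := by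
  induction β using Finsupp.induction with
  | zero => rw [derOp_zero, one_mul, mul_one]
  | single_add i k β hi hk ih =>
    have hsupp : (Finsupp.single i k + β).support = insert i β.support := by
      ext j
      by_cases hj : i = j
      · subst hj
        simp [hk]
      · simp [Ne.symm hj]
    rw [hsupp] at hβ
    rw [derOp_single_add i k β hi, mul_assoc, ih fun j hj => hβ j (Finset.mem_insert_of_mem hj),
      ← mul_assoc, derOp_single, dOp_commute_polyOp (hβ i (Finset.mem_insert_self _ _)) k hf,
      mul_assoc]

/-- The commutation relation evaluated at `g`: `∂_i ^ [m]` is linear over polynomials free of `x_i`.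
-/
theorem divDer_single_mul_of_supported {i : Fin n} {s : Set (Fin n)} (hi : i ∉ s) (m : ℕ)
    {f : MvPolynomial (Fin n) K} (hf : f ∈ supported K s) (g : MvPolynomial (Fin n) K) :
    divDer K n (Finsupp.single i m) (f * g) = f * divDer K n (Finsupp.single i m) g := by
  have h := congrArg (fun T : diffOps K n => (T : Module.End K (MvPolynomial (Fin n) K)) g)
    (dOp_commute_polyOp hi m hf)
  exact h

/-- On polynomials in `x_i` with coefficients in which `x_i` does not occur, `∂_i ^ [m]` is the
Hasse derivative. -/
theorem divDer_single_aeval {i : Fin n} {s : Set (Fin n)} (hi : i ∉ s) (m : ℕ)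
    (G : Polynomial (supported K s)) :
    divDer K n (Finsupp.single i m) (Polynomial.aeval (X i : MvPolynomial (Fin n) K) G) =
      Polynomial.aeval (X i : MvPolynomial (Fin n) K) (Polynomial.hasseDeriv m G) := by
  induction G using Polynomial.induction_on' with
  | add G H hG hH => simp only [map_add, hG, hH]
  | monomial b c =>
    have hc : ∀ c : supported K s, algebraMap (supported K s) (MvPolynomial (Fin n) K) c = c :=
      fun _ => rfl
    rw [Polynomial.hasseDeriv_monomial, Polynomial.aeval_monomial, Polynomial.aeval_monomial,
      map_mul (algebraMap (supported K s) _), map_natCast, hc, divDer_single_mul_of_supported hi m c.2, X_pow_eq_monomial,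
      divDer_single_monomial, X_pow_eq_monomial, ← Finsupp.single_tsub, one_mul,
      Finsupp.single_eq_same, mul_comm ((b.choose m : ℕ) : MvPolynomial (Fin n) K), mul_assoc,
      ← map_natCast (C : K →+* MvPolynomial (Fin n) K), C_mul_monomial, mul_one]

theorem aeval_X_mem_supported {i : Fin n} {s t : Set (Fin n)} (hst : s ⊆ t) (hi : i ∈ t)
    (G : Polynomial (supported K s)) :
    Polynomial.aeval (X i : MvPolynomial (Fin n) K) G ∈ supported K t := by
  induction G using Polynomial.induction_on' with
  | add G H hG hH => rw [map_add]; exact add_mem hG hH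
  | monomial b c =>
    rw [Polynomial.aeval_monomial]
    exact mul_mem (supported_mono hst c.2) (pow_mem (X_mem_supported.mpr hi) b)

theorem monomial_mem_supported {s : Set (Fin n)} {γ : Fin n →₀ ℕ} (hγ : ∀ i ∈ γ.support, i ∈ s)
    (c : K) : monomial γ c ∈ supported K s := by
  rw [mem_supported]
  intro i hi
  rw [Finset.mem_coe, mem_vars_iff_mem_support] at hi
  obtain ⟨δ, hδ, hi⟩ := hi
  rw [Finset.mem_singleton.mp (support_monomial_subset hδ)] at hi
  exact hγ i hi

end Operators

/-! ### Free action of divided powers on a module over the polynomials -/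

section Free

open MvPolynomial

variable {K : Type u} [Field K] {n : ℕ} {M : Type w} [AddCommGroup M] [Module K M]
  [Module (diffOps K n) M] [IsScalarTower K (diffOps K n) M]

/-- If `Q` annihilates `y` and the derivatives `∂_i ^ [a] Q` vanish unless `q ∣ a`, then
multiplication by `Q` lowers the order of `∂_i ^ [b q] y`. -/
theorem polyOp_smul_dOp_smul (i : Fin n) {q : ℕ} (hq : 0 < q) (Q : MvPolynomial (Fin n) K)
    (hz : ∀ a, ¬ q ∣ a → divDer K n (Finsupp.single i a) Q = 0) (y : M)
    (hy : polyOp K n Q • y = 0) (b : ℕ) :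
    polyOp K n Q • dOp K n i (b * q) • y = ∑ c ∈ Finset.range b, dOp K n i (c * q) •
      ((-1 : K) ^ ((b - c) * q) •
        polyOp K n (divDer K n (Finsupp.single i ((b - c) * q)) Q) • y) := by
  rw [← mul_smul, polyOp_mul_dOp, Finset.sum_smul]
  symm
  -- Of the pairs `(a, c)` with `a + c = b q`, only those with `q ∣ a` contribute, and `a = 0` drops
  -- out because `Q` kills `y`.
  refine Finset.sum_of_injOn (fun c => ((b - c) * q, c * q)) ?_ ?_ ?_ ?_
  · intro c _ d _ h
    exact Nat.eq_of_mul_eq_mul_right hq (Prod.ext_iff.mp h).2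
  · intro c hc
    rw [Finset.mem_coe, Finset.mem_range] at hc
    rw [Finset.mem_coe, Finset.HasAntidiagonal.mem_antidiagonal]
    change (b - c) * q + c * q = b * q
    rw [← Nat.add_mul, Nat.sub_add_cancel hc.le]
  · rintro ⟨a, c⟩ hac hnot
    rw [Finset.HasAntidiagonal.mem_antidiagonal] at hac
    change a + c = b * q at hac
    rw [smul_assoc, mul_smul]
    by_cases hqa : q ∣ a
    · obtain ⟨a', rfl⟩ := hqa
      have hqc : q ∣ c := (Nat.dvd_add_right (Dvd.intro _ rfl)).mp
        (hac ▸ Dvd.intro_left b rfl)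
      obtain ⟨c', rfl⟩ := hqc
      rw [← Nat.mul_add, mul_comm b q] at hac
      have hb := Nat.eq_of_mul_eq_mul_left hq hac
      by_cases ha : a' = 0
      · subst ha
        simp only [mul_zero, Finsupp.single_zero, divDer_zero, Module.End.one_apply, hy,
          smul_zero]
      · refine absurd ?_ hnot
        refine ⟨c', by rw [Finset.mem_coe, Finset.mem_range]; omega, ?_⟩
        change ((b - c') * q, c' * q) = _
        rw [mul_comm q, mul_comm q, ← hb, Nat.add_sub_cancel]
    · simp only [hz a hqa, map_zero, zero_smul, smul_zero]
  · intro c _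
    change _ = ((-1 : K) ^ ((b - c) * q) • _) • y
    rw [smul_assoc, mul_smul, smul_algebra_smul_comm]

/-- If `Q` annihilates `N`, the derivatives `∂_i ^ [a] Q` vanish unless `q ∣ a` and preserve `N`,
and `∂_i ^ [q] Q` is injective on `N`, then the sum of the `∂_i ^ [b q] N` is direct, and
each `∂_i ^ [b q]` is injective on `N`. -/
theorem eq_zero_of_sum_dOp_smul_eq_zero (i : Fin n) {q : ℕ} (hq : 0 < q)
    (Q : MvPolynomial (Fin n) K)
    (hz : ∀ a, ¬ q ∣ a → divDer K n (Finsupp.single i a) Q = 0) (N : Submodule K M)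
    (hQ : ∀ y ∈ N, polyOp K n Q • y = 0)
    (hN : ∀ a, ∀ y ∈ N, polyOp K n (divDer K n (Finsupp.single i a) Q) • y ∈ N)
    (hinj : ∀ y ∈ N, polyOp K n (divDer K n (Finsupp.single i q) Q) • y = 0 → y = 0)
    (J : ℕ) : ∀ y : ℕ → M, (∀ b, y b ∈ N) →
      ∑ b ∈ Finset.range J, dOp K n i (b * q) • y b = 0 → ∀ b < J, y b = 0 := by
  induction J with
  | zero => intro y _ _ b hb; exact absurd hb (Nat.not_lt_zero b)
  | succ J ih =>
    intro y hy hsum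
    have htop : y J = 0 := by
      -- Multiplying the relation by `Q` lowers every order by at least one `q`, leaving a relation
      -- of length `J` whose new coefficients again lie in `N`.
      have h1 : ∑ c ∈ Finset.range J, dOp K n i (c * q) • ∑ b ∈ Finset.Ioc c J,
          ((-1 : K) ^ ((b - c) * q) •
            polyOp K n (divDer K n (Finsupp.single i ((b - c) * q)) Q) • y b) = 0 := by
        have h2 : ∑ b ∈ Finset.range (J + 1), polyOp K n Q • dOp K n i (b * q) • y b = 0 := by
          rw [← Finset.smul_sum, hsum, smul_zero]
        rw [Finset.sum_congr rfl fun b _ =>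
          polyOp_smul_dOp_smul i hq Q hz (y b) (hQ _ (hy b)) b] at h2
        simp only [Finset.smul_sum (r := (_ : diffOps K n))]
        rw [← h2]
        refine Finset.sum_comm' fun c b => ?_
        simp only [Finset.mem_range, Finset.mem_Ioc]
        omega
      -- For length one the relation already reads `y 0 = 0`. Otherwise the top new coefficient
      -- involves only `b = J + 1`, namely `± (∂_i ^ [q] Q) y (J + 1)`, and injectivity applies.
      rcases J with _ | J
      · rw [zero_add, Finset.sum_range_one, zero_mul, ← derOp_single, Finsupp.single_zero,
          derOp_zero, one_smul] at hsum
        exact hsum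
      · have h3 := ih _ (fun c => Submodule.sum_mem _ fun b _ =>
          Submodule.smul_mem _ _ (hN _ _ (hy b))) h1 J (Nat.lt_succ_self J)
        rw [Finset.sum_eq_single (J + 1)] at h3
        · rw [Nat.add_sub_cancel_left, one_mul] at h3
          refine hinj _ (hy _) ((smul_eq_zero.mp h3).resolve_left ?_)
          exact pow_ne_zero _ (neg_ne_zero.mpr one_ne_zero)
        · intro b hb hne
          rw [Finset.mem_Ioc] at hb
          omega
        · intro h
          exact absurd (Finset.mem_Ioc.mpr ⟨Nat.lt_succ_self J, le_rfl⟩) h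
    rw [Finset.sum_range_succ, htop, smul_zero, add_zero] at hsum
    intro b hb
    rcases Nat.lt_succ_iff_lt_or_eq.mp hb with hb | rfl
    · exact ih y hy hsum b hb
    · exact htop

/-- The exponent `(m_i γ_i)_i`. -/
noncomputable def scale (m : Fin n → ℕ) (γ : Fin n →₀ ℕ) : Fin n →₀ ℕ :=
  Finsupp.equivFunOnFinite.symm fun i => γ i * m i

@[simp] theorem scale_apply (m : Fin n → ℕ) (γ : Fin n →₀ ℕ) (i : Fin n) :
    scale m γ i = γ i * m i := rfl

theorem support_scale_subset (m : Fin n → ℕ) (γ : Fin n →₀ ℕ) :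
    (scale m γ).support ⊆ γ.support := by
  intro i hi
  rw [Finsupp.mem_support_iff, scale_apply] at hi
  exact Finsupp.mem_support_iff.mpr (left_ne_zero_of_mul hi)

theorem scale_erase_add (m : Fin n → ℕ) (γ : Fin n →₀ ℕ) (i : Fin n) :
    scale m γ = Finsupp.single i (γ i * m i) + scale m (γ.erase i) := by
  ext j
  by_cases hj : i = j
  · subst hj
    simp
  · simp [hj, Finsupp.erase_ne (Ne.symm hj)]

/-- The operators `∂ ^ [m γ]`, for exponents `γ` supported in a set `T` of indices, act freely on
`W`, if for each `i ∈ T` there is a polynomial `Q` in `x_1, …, x_i` annihilating `W` for which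
`∂_i ^ [a] Q = 0` unless `m_i ∣ a` and `∂_i ^ [m_i] Q` is injective on `W`. -/
theorem eq_zero_of_sum_derOp_smul_eq_zero (m : Fin n → ℕ) (W : Submodule K M)
    (hW : ∀ f, ∀ x ∈ W, polyOp K n f • x ∈ W) (T : Finset (Fin n))
    (hT : ∀ i ∈ T, 0 < m i ∧ ∃ Q ∈ supported K (Set.Iic i),
      (∀ a, divDer K n (Finsupp.single i a) Q ∈ supported K (Set.Iic i)) ∧
      (∀ a, ¬ m i ∣ a → divDer K n (Finsupp.single i a) Q = 0) ∧
      (∀ x ∈ W, polyOp K n Q • x = 0) ∧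
      ∀ x ∈ W, polyOp K n (divDer K n (Finsupp.single i (m i)) Q) • x = 0 → x = 0) :
    ∀ (ι : Type) (G : Finset ι) (e : ι → Fin n →₀ ℕ), Set.InjOn e G →
      (∀ g ∈ G, (e g).support ⊆ T) → ∀ x : ι → M, (∀ g ∈ G, x g ∈ W) →
      ∑ g ∈ G, derOp K (scale m (e g)) • x g = 0 → ∀ g ∈ G, x g = 0 := by
  classical
  -- The new index lies below all of `T`, so its `Q`, a polynomial in the variables up to `x_i`,
  -- commutes with every `∂_j`, `j ∈ T`.
  induction T using Finset.induction_on_min with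
  | empty =>
    intro ι G e he hsupp x hx hsum g hg
    have hone : ∀ h ∈ G, e h = 0 := fun h hh =>
      Finsupp.support_eq_empty.mp (Finset.subset_empty.mp (hsupp h hh))
    have hG : G = {g} := by
      refine Finset.eq_singleton_iff_unique_mem.mpr ⟨hg, fun h hh => ?_⟩
      exact he hh hg (by rw [hone h hh, hone g hg])
    rw [hG, Finset.sum_singleton, hone g hg] at hsum
    have h0 : scale m (0 : Fin n →₀ ℕ) = 0 := by
      ext
      simp
    rwa [h0, derOp_zero, one_smul] at hsum
  | insert i T hi ih =>
    have ih := ih fun j hj => hT j (Finset.mem_insert_of_mem hj)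
    obtain ⟨hm, Q, hQs, hQd, hQz, hQW, hQinj⟩ := hT i (Finset.mem_insert_self i T)
    have hiT : i ∉ T := fun h => lt_irrefl _ (hi i h)
    -- operators in `∂_j`, `j ∈ T`, commute with polynomials in `x_1, …, x_i`
    have hcomm : ∀ γ : Fin n →₀ ℕ, γ.support ⊆ T → ∀ f ∈ supported K (Set.Iic i), ∀ x : M,
        polyOp K n f • derOp K (scale m γ) • x = derOp K (scale m γ) • polyOp K n f • x := by
      intro γ hγ f hf x
      rw [← mul_smul, ← mul_smul, derOp_commute_polyOp (fun j hj => ?_) hf]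
      exact not_le.mpr (hi j (hγ (support_scale_subset m γ hj)))
    let D : {γ : Fin n →₀ ℕ // γ.support ⊆ T} → M →ₗ[K] M := fun γ =>
      DistribSMul.toLinearMap K M (derOp K (scale m γ.1))
    -- The space generated from `W` by the operators already treated; the one-variable statement is
    -- applied to it in place of `W`.
    let N : Submodule K M := ⨆ γ, W.map (D γ)
    have hmemN : ∀ y ∈ N, ∃ (G : Finset {γ : Fin n →₀ ℕ // γ.support ⊆ T})
        (x : {γ : Fin n →₀ ℕ // γ.support ⊆ T} → M), (∀ g ∈ G, x g ∈ W) ∧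
          y = ∑ g ∈ G, derOp K (scale m g.1) • x g := by
      intro y hy
      obtain ⟨f, hf, rfl⟩ := (Submodule.mem_iSup_iff_exists_finsupp _ _).mp hy
      choose x hx hxf using hf
      exact ⟨f.support, x, fun g _ => hx g, Finset.sum_congr rfl fun g _ => (hxf g).symm⟩
    have hNmem : ∀ (γ : Fin n →₀ ℕ), γ.support ⊆ T → ∀ x ∈ W,
        derOp K (scale m γ) • x ∈ N := fun γ hγ x hx =>
      Submodule.mem_iSup_of_mem (p := fun γ => W.map (D γ)) ⟨γ, hγ⟩ ⟨x, hx, rfl⟩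
    have hact : ∀ f ∈ supported K (Set.Iic i), ∀ (G : Finset {γ : Fin n →₀ ℕ // γ.support ⊆ T})
        (x : {γ : Fin n →₀ ℕ // γ.support ⊆ T} → M),
        polyOp K n f • ∑ g ∈ G, derOp K (scale m g.1) • x g =
          ∑ g ∈ G, derOp K (scale m g.1) • polyOp K n f • x g := by
      intro f hf G x
      rw [Finset.smul_sum]
      exact Finset.sum_congr rfl fun g _ => hcomm g.1 g.2 f hf (x g)
    intro ι G e he hsupp x hx hsum
    -- collect the terms according to the exponent of `∂_i`
    let y : ℕ → M := fun b => ∑ g ∈ G with e g i = b, derOp K (scale m ((e g).erase i)) • x g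
    have herase : ∀ g ∈ G, ((e g).erase i).support ⊆ T := by
      intro g hg
      rw [Finsupp.support_erase]
      intro j hj
      rw [Finset.mem_erase] at hj
      exact (Finset.mem_insert.mp (hsupp g hg hj.2)).resolve_left hj.1
    have hyN : ∀ b, y b ∈ N := fun b => Submodule.sum_mem _ fun g hg =>
      hNmem _ (herase g (Finset.mem_filter.mp hg).1) _ (hx g (Finset.mem_filter.mp hg).1)
    have hterm : ∀ g ∈ G, derOp K (scale m (e g)) • x g =
        dOp K n i (e g i * m i) • derOp K (scale m ((e g).erase i)) • x g := by
      intro g hg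
      rw [scale_erase_add m (e g) i, derOp_single_add, derOp_single, mul_smul]
      exact fun h => hiT (herase g hg (support_scale_subset _ _ h))
    have hysum : ∑ b ∈ Finset.range (G.sup (fun g => e g i) + 1), dOp K n i (b * m i) • y b = 0 := by
      rw [← hsum, Finset.sum_congr rfl hterm]
      rw [← Finset.sum_fiberwise_of_maps_to (s := G) (g := fun g => e g i)
        (t := Finset.range (G.sup (fun g => e g i) + 1))
        (fun g hg => Finset.mem_range.mpr (Nat.lt_succ_of_le
          (Finset.le_sup (f := fun g => e g i) hg)))]
      refine Finset.sum_congr rfl fun b _ => ?_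
      rw [Finset.smul_sum]
      refine Finset.sum_congr rfl fun g hg => ?_
      rw [(Finset.mem_filter.mp hg).2]
    have hy0 := eq_zero_of_sum_dOp_smul_eq_zero i hm Q hQz N
      (by
        intro z hz
        obtain ⟨G', x', hx', rfl⟩ := hmemN z hz
        rw [hact Q hQs]
        exact Finset.sum_eq_zero fun g hg => by rw [hQW _ (hx' g hg), smul_zero])
      (by
        intro a z hz
        obtain ⟨G', x', hx', rfl⟩ := hmemN z hz
        rw [hact _ (hQd a)]
        exact Submodule.sum_mem _ fun g hg => hNmem g.1 g.2 _ (hW _ _ (hx' g hg)))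
      (by
        intro z hz hz0
        obtain ⟨G', x', hx', rfl⟩ := hmemN z hz
        rw [hact _ (hQd _)] at hz0
        -- Injectivity passes from `W` to `N` because, by induction, the sum defining `N` is direct
        -- with injective operators.
        have h1 := ih _ G' Subtype.val Subtype.val_injective.injOn (fun g _ => g.2) _
          (fun g hg => hW _ _ (hx' g hg)) hz0
        exact Finset.sum_eq_zero fun g hg => by rw [hQinj _ (hx' g hg) (h1 g hg), smul_zero])
      _ y hyN hysum
    intro g hg
    refine ih ι (G.filter fun h => e h i = e g i) (fun h => (e h).erase i) ?_
      (fun h hh => herase h (Finset.mem_filter.mp hh).1) x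
      (fun h hh => hx h (Finset.mem_filter.mp hh).1)
      (hy0 (e g i) (Nat.lt_succ_of_le (Finset.le_sup (f := fun g => e g i) hg))) g
      (Finset.mem_filter.mpr ⟨hg, rfl⟩)
    intro h hh h' hh' hEq
    rw [Finset.mem_coe, Finset.mem_filter] at hh hh'
    refine he hh.1 hh'.1 ?_
    rw [← Finsupp.single_add_erase i (e h), ← Finsupp.single_add_erase i (e h'), hh.2, hh'.2]
    exact congrArg _ hEq

end Free

/-! ### Vanishing of binomials and Hasse derivatives in characteristic `p` -/

/-- The binomial coefficient `(p ^ k * b).choose a` is divisible by `p` unless `p ^ k ∣ a`. -/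
theorem prime_dvd_choose_primePow_mul {p : ℕ} (hp : p.Prime) (k b : ℕ) :
    ∀ a, ¬ p ^ k ∣ a → p ∣ (p ^ k * b).choose a := by
  have := Fact.mk hp
  induction k with
  | zero => intro a ha; exact absurd (by simp) ha
  | succ k ih =>
    intro a ha
    have h := Choose.choose_modEq_choose_mod_mul_choose_div_nat (p := p)
      (n := p ^ (k + 1) * b) (k := a)
    rw [show p ^ (k + 1) * b = p * (p ^ k * b) by ring] at h ⊢
    rw [Nat.mul_mod_right, Nat.mul_div_cancel_left _ hp.pos] at h
    rw [h.dvd_iff dvd_rfl]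
    by_cases hpa : p ∣ a
    · obtain ⟨c, rfl⟩ := hpa
      rw [Nat.mul_div_cancel_left _ hp.pos]
      refine Dvd.dvd.mul_left (ih c fun hc => ha ?_) _
      rw [pow_succ']
      exact Nat.mul_dvd_mul_left p hc
    · rw [Nat.choose_eq_zero_of_lt (Nat.pos_of_ne_zero fun h0 => hpa (Nat.dvd_of_mod_eq_zero h0)),
        zero_mul]
      exact dvd_zero p

/-- The coefficients involve `(c + a).choose a`; where `G` has a term, `p ^ k ∣ c + a`, and then `p`
divides this binomial. -/
theorem hasseDeriv_eq_zero_of_not_dvd {K R : Type*} [Field K] [CommRing R] [Algebra K R] {p : ℕ}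
    (hp : p.Prime) [CharP K p] {k : ℕ} {G : Polynomial R}
    (hG : ∀ a, ¬ p ^ k ∣ a → G.coeff a = 0) {a : ℕ} (ha : ¬ p ^ k ∣ a) :
    Polynomial.hasseDeriv a G = 0 := by
  ext c
  rw [Polynomial.hasseDeriv_coeff, Polynomial.coeff_zero]
  by_cases hc : p ^ k ∣ c + a
  · obtain ⟨b, hb⟩ := hc
    have h0 : (((c + a).choose a : ℕ) : K) = 0 := by
      rw [CharP.cast_eq_zero_iff K p, hb]
      exact prime_dvd_choose_primePow_mul hp k b a ha
    rw [← map_natCast (algebraMap K R), h0, map_zero, zero_mul]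
  · rw [hG _ hc, mul_zero]

/-! ### Independence of bounded monomials modulo the ideal -/

section Prime

open MvPolynomial

variable {K : Type u} [Field K] {n : ℕ}

/-- A polynomial in a prime ideal vanishes if its degrees are smaller than the degrees of the
variables modulo the ideal over the preceding variables. -/
theorem eq_zero_of_mem_of_degree_lt (I : Ideal (MvPolynomial (Fin n) K)) (hI : I ≠ ⊤)
    (S : Finset (Fin n)) (d : Fin n → ℕ)
    (h : ∀ i, ∀ H : Polynomial (supported K (Set.Iio i)), (i ∉ S → ∀ a, d i ≤ a → H.coeff a = 0) →
      Polynomial.aeval (X i : MvPolynomial (Fin n) K) H ∈ I →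
        ∀ a, (H.coeff a : MvPolynomial (Fin n) K) ∈ I)
    (F : MvPolynomial (Fin n) K) (hF : ∀ γ ∈ F.support, ∀ i ∉ S, γ i < d i) (hFI : F ∈ I) :
    F = 0 := by
  classical
  -- Induct on the number `j` of variables allowed to occur; a constant in a proper ideal is zero.
  suffices hj : ∀ j, ∀ F : MvPolynomial (Fin n) K, (∀ γ ∈ F.support, ∀ i : Fin n, j ≤ i.val →
      γ i = 0) → (∀ γ ∈ F.support, ∀ i ∉ S, γ i < d i) → F ∈ I → F = 0 from
    hj n F (fun _ _ i hi => absurd i.isLt (not_lt.mpr hi)) hF hFI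
  clear hF hFI F
  intro j
  induction j with
  | zero =>
    intro F hF0 _ hFI
    have hC : F = C (coeff 0 F) := by
      ext γ
      rw [coeff_C]
      split_ifs with h0
      · rw [h0]
      · by_contra hγ
        refine h0 (Finsupp.ext fun i => ?_).symm
        exact hF0 γ (mem_support_iff.mpr hγ) i (Nat.zero_le _)
    by_contra hne
    refine hI (Ideal.eq_top_of_isUnit_mem _ hFI ?_)
    rw [hC]
    refine (IsUnit.mk0 _ fun h0 => hne ?_).map C
    rw [hC, h0, C_0]
  | succ j ih =>
    intro F hF0 hF hFI
    by_cases hjn : j < n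
    swap
    · exact ih F (fun γ hγ i hi => absurd i.isLt (by omega)) hF hFI
    let i : Fin n := ⟨j, hjn⟩
    have hlt : ∀ γ ∈ F.support, ∀ l ∈ (γ.erase i).support, l ∈ Set.Iio i := by
      intro γ hγ l hl
      rw [Finsupp.support_erase, Finset.mem_erase, Finsupp.mem_support_iff] at hl
      by_contra hli
      have h1 : j ≤ l.val := not_lt.mp hli
      have h2 : l.val ≠ j := fun h => hl.1 (Fin.ext h)
      exact hl.2 (hF0 γ hγ l (by omega))
    -- `F` regarded as a polynomial in its last variable `x_i`; the hypothesis puts its coefficients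
    -- in the ideal, and these involve fewer variables.
    let H : Polynomial (supported K (Set.Iio i)) := ∑ γ ∈ F.support.attach,
      Polynomial.monomial (γ.1 i)
        ⟨monomial (γ.1.erase i) (coeff γ.1 F), monomial_mem_supported (hlt γ.1 γ.2) _⟩
    have hHF : Polynomial.aeval (X i : MvPolynomial (Fin n) K) H = F := by
      conv_rhs => rw [F.as_sum, ← Finset.sum_attach]
      rw [map_sum]
      refine Finset.sum_congr rfl fun γ _ => ?_
      rw [Polynomial.aeval_monomial]
      change monomial (γ.1.erase i) (coeff γ.1 F) * X i ^ γ.1 i = _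
      rw [X_pow_eq_monomial, monomial_mul, mul_one, Finsupp.erase_add_single]
    have hcoeff : ∀ a, (H.coeff a : MvPolynomial (Fin n) K) =
        ∑ γ ∈ F.support with γ i = a, monomial (γ.erase i) (coeff γ F) := by
      intro a
      rw [Polynomial.finsetSum_coeff, AddSubmonoidClass.coe_finsetSum, Finset.sum_filter,
        ← Finset.sum_attach F.support]
      refine Finset.sum_congr rfl fun γ _ => ?_
      rw [Polynomial.coeff_monomial]
      split_ifs <;> rfl
    have hsupp : ∀ a, ∀ δ ∈ (H.coeff a : MvPolynomial (Fin n) K).support,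
        ∃ γ ∈ F.support, γ i = a ∧ γ.erase i = δ := by
      intro a δ hδ
      rw [hcoeff] at hδ
      obtain ⟨γ, hγ, hδ⟩ := Finset.mem_biUnion.mp (support_sum hδ)
      rw [Finset.mem_filter] at hγ
      exact ⟨γ, hγ.1, hγ.2, (Finset.mem_singleton.mp (support_monomial_subset hδ)).symm⟩
    have hHI := h i H (by
      intro hiS a ha
      apply Subtype.ext
      rw [hcoeff]
      refine Finset.sum_eq_zero fun γ hγ => ?_
      rw [Finset.mem_filter] at hγ
      exact absurd (hF γ hγ.1 i hiS) (by omega)) (hHF.symm ▸ hFI)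
    have hH0 : ∀ a, (H.coeff a : MvPolynomial (Fin n) K) = 0 := by
      intro a
      refine ih _ ?_ ?_ (hHI a)
      · intro δ hδ l hl
        obtain ⟨γ, hγ, -, rfl⟩ := hsupp a δ hδ
        by_cases hli : l = i
        · rw [hli, Finsupp.erase_same]
        · rw [Finsupp.erase_ne hli]
          refine hF0 γ hγ l ?_
          have : l.val ≠ j := fun h => hli (Fin.ext h)
          omega
      · intro δ hδ l hl
        obtain ⟨γ, hγ, -, rfl⟩ := hsupp a δ hδ
        by_cases hli : l = i
        · rw [hli, Finsupp.erase_same]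
          exact (Nat.zero_le _).trans_lt (hF γ hγ i (hli ▸ hl))
        · rw [Finsupp.erase_ne hli]
          exact hF γ hγ l hl
    rw [← hHF]
    have : H = 0 := Polynomial.ext fun a => Subtype.ext (hH0 a)
    rw [this, map_zero]

end Prime

/-! ### Construction of the subspace `V` -/

section Family

open MvPolynomial

variable {K : Type u} [Field K] {n : ℕ} {M : Type w} [AddCommGroup M]
  [Module (diffOps K n) M]

/-- A nonzero `D(P_n)`-module has an element whose annihilator in `P_n` is a prime ideal. -/
theorem exists_prime_annihilator [Nontrivial M] :
    ∃ (I : Ideal (MvPolynomial (Fin n) K)) (x : M), I.IsPrime ∧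
      ∀ f, f ∈ I ↔ polyOp K n f • x = 0 := by
  obtain ⟨y, hy⟩ := exists_ne (0 : M)
  let _ : Module (MvPolynomial (Fin n) K) M := Module.compHom M (polyOp K n).toRingHom
  obtain ⟨I, hI, -⟩ := exists_le_isAssociatedPrime_of_isNoetherianRing
    (MvPolynomial (Fin n) K) y hy
  obtain ⟨hprime, x, hx⟩ := isAssociatedPrime_iff.mp hI
  refine ⟨I, x, hprime, fun f => ?_⟩
  rw [hx, Submodule.mem_colon_singleton, Submodule.mem_bot]
  rfl

variable (K) in
/-- The operator `x ^ α ∂ ^ [m β]`, where `α` and `β` are the parts of `γ` in `S` and in the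
complement of `S`. -/
noncomputable def mixedOp (S : Finset (Fin n)) (m : Fin n → ℕ) (γ : Fin n →₀ ℕ) : diffOps K n :=
  polyOp K n (monomial (γ.filter (· ∈ S)) 1) * derOp K (scale m (γ.filter (· ∉ S)))

/-- The exponents that vanish on `S` and are less than `d` off `S`. -/
noncomputable def boundedExponents (S : Finset (Fin n)) (d : Fin n → ℕ) : Finset (Fin n →₀ ℕ) :=
  (Fintype.piFinset fun i => Finset.range (if i ∈ S then 1 else d i)).map
    Finsupp.equivFunOnFinite.symm.toEmbedding

theorem mem_boundedExponents {S : Finset (Fin n)} {d : Fin n → ℕ} {γ : Fin n →₀ ℕ} :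
    γ ∈ boundedExponents S d ↔ (∀ i ∈ S, γ i = 0) ∧ ∀ i ∉ S, γ i < d i := by
  rw [boundedExponents, Finset.mem_map_equiv, Fintype.mem_piFinset]
  simp only [Finset.mem_range]
  constructor
  · intro h
    refine ⟨fun i hi => ?_, fun i hi => ?_⟩
    · have := h i
      rw [if_pos hi] at this
      exact Nat.lt_one_iff.mp this
    · have := h i
      rwa [if_neg hi] at this
  · rintro ⟨h1, h2⟩ i
    split_ifs with hi
    · exact Nat.lt_one_iff.mpr (h1 i hi)
    · exact h2 i hi

theorem card_boundedExponents (S : Finset (Fin n)) (d : Fin n → ℕ) :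
    (boundedExponents S d).card = ∏ i ∈ Sᶜ, d i := by
  rw [boundedExponents, Finset.card_map, Fintype.card_piFinset, ← Finset.prod_subset
    (Finset.subset_univ Sᶜ)]
  · refine Finset.prod_congr rfl fun i hi => ?_
    rw [Finset.card_range, if_neg (Finset.mem_compl.mp hi)]
  · intro i _ hi
    rw [Finset.mem_compl, not_not] at hi
    rw [Finset.card_range, if_pos hi]

/-- The `x` part lives on `S` and the `∂` part off `S`, so they commute and the monomial can be
absorbed into `f`. -/
theorem mixedOp_smul_polyOp_smul (S : Finset (Fin n)) (m : Fin n → ℕ) (γ : Fin n →₀ ℕ)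
    (f : MvPolynomial (Fin n) K) (x : M) :
    mixedOp K S m γ • polyOp K n f • x = derOp K (scale m (γ.filter (· ∉ S))) •
      polyOp K n (monomial (γ.filter (· ∈ S)) 1 * f) • x := by
  have hc := derOp_commute_polyOp (s := (S : Set (Fin n))) (β := scale m (γ.filter (· ∉ S)))
    (f := monomial (γ.filter (· ∈ S)) (1 : K))
    (fun i hi => by
      have h := support_scale_subset _ _ hi
      rw [Finsupp.support_filter, Finset.mem_filter] at h
      exact h.2)
    (monomial_mem_supported (fun i hi => by
      rw [Finsupp.support_filter, Finset.mem_filter] at hi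
      exact hi.2) 1)
  rw [mixedOp, ← hc, map_mul, mul_smul, mul_smul]

variable [Module K M] [IsScalarTower K (diffOps K n) M]

/-- Every nonzero `D(P_n)`-module has a finite dimensional subspace `V`
of dimension at least `p ^ ∑ k_i` on which the operators `x ^ α ∂ ^ [p ^ k β]` act freely. -/
theorem exists_free_subspace {p : ℕ} (hp : p.Prime) [CharP K p] [Nontrivial M] :
    ∃ (S : Finset (Fin n)) (k : Fin n → ℕ) (V : Submodule K M), FiniteDimensional K V ∧
      p ^ (∑ i ∈ Sᶜ, k i) ≤ Module.finrank K V ∧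
      ∀ (G : Finset (Fin n →₀ ℕ)) (x : (Fin n →₀ ℕ) → M), (∀ g ∈ G, x g ∈ V) →
        ∑ g ∈ G, mixedOp K S (fun i => p ^ k i) g • x g = 0 → ∀ g ∈ G, x g = 0 := by
  classical
  obtain ⟨I, v, hI, hv⟩ := exists_prime_annihilator (K := K) (n := n) (M := M)
  -- The indices whose variable is transcendental modulo `I` over the preceding ones.
  let S : Finset (Fin n) := Finset.univ.filter fun i =>
    ∀ G : Polynomial (supported K (Set.Iio i)),
      Polynomial.aeval (X i : MvPolynomial (Fin n) K) G ∈ I →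
        ∀ a, (G.coeff a : MvPolynomial (Fin n) K) ∈ I
  have hS : ∀ i, i ∈ S ↔ ∀ G : Polynomial (supported K (Set.Iio i)),
      Polynomial.aeval (X i : MvPolynomial (Fin n) K) G ∈ I →
        ∀ a, (G.coeff a : MvPolynomial (Fin n) K) ∈ I := fun i => by
    simp only [S, Finset.mem_filter, Finset.mem_univ, true_and]
  -- The condition `i ∉ S` is placed inside so that `k` and `G` become total functions; on `S` their
  -- values are dummies.
  have hex : ∀ i, ∃ (k : ℕ) (G : Polynomial (supported K (Set.Iio i))), i ∉ S →
      (∀ a, ¬ p ^ k ∣ a → G.coeff a = 0) ∧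
      Polynomial.aeval (X i : MvPolynomial (Fin n) K) G ∈ I ∧
      Polynomial.aeval (X i : MvPolynomial (Fin n) K) (Polynomial.hasseDeriv (p ^ k) G) ∉ I ∧
      ∀ H : Polynomial (supported K (Set.Iio i)), (∀ a, p ^ k ≤ a → H.coeff a = 0) →
        Polynomial.aeval (X i : MvPolynomial (Fin n) K) H ∈ I →
          ∀ a, (H.coeff a : MvPolynomial (Fin n) K) ∈ I := by
    intro i
    by_cases hi : i ∈ S
    · exact ⟨0, 0, fun h => absurd hi h⟩
    · have h1 := hi
      rw [hS] at h1
      obtain ⟨k, G, h⟩ := exists_separable_in_primePow (K := K) hp I (X i) h1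
      exact ⟨k, G, fun _ => h⟩
  choose k G hG using hex
  have hzero := eq_zero_of_mem_of_degree_lt I hI.ne_top S (fun i => p ^ k i) (by
    intro i H hH hHI
    by_cases hi : i ∈ S
    · exact (hS i).mp hi H hHI
    · exact (hG i hi).2.2.2 H (hH hi) hHI)
  let φ : MvPolynomial (Fin n) K →ₗ[K] M :=
    { toFun := fun f => polyOp K n f • v
      map_add' := fun f g => by rw [map_add, add_smul]
      map_smul' := fun c f => by rw [map_smul, smul_assoc, RingHom.id_apply] }
  have hφ : ∀ f, φ f = polyOp K n f • v := fun _ => rfl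
  have hφ0 : ∀ f, φ f = 0 ↔ f ∈ I := fun f => (hv f).symm
  have hact : ∀ f g, polyOp K n f • φ g = φ (f * g) := fun f g => by
    rw [hφ, hφ, map_mul, mul_smul]
  let E := boundedExponents S fun i => p ^ k i
  -- `V` will be the image `U v`, and `hzero` makes `U → M` injective, whence the dimension.
  let U : Submodule K (MvPolynomial (Fin n) K) := restrictSupport K (E : Set (Fin n →₀ ℕ))
  have hUE : ∀ f ∈ U, ∀ γ ∈ f.support, γ ∈ E := fun f hf γ hγ =>
    Finset.mem_coe.mp ((mem_restrictSupport_iff K).mp hf (Finset.mem_coe.mpr hγ))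
  have hinj : Function.Injective (φ.domRestrict U) := by
    rw [← LinearMap.ker_eq_bot, LinearMap.ker_eq_bot']
    intro f hf
    apply Subtype.ext
    refine hzero f.1 (fun γ hγ i hi => ?_) ((hφ0 _).mp hf)
    exact (mem_boundedExponents.mp (hUE f.1 f.2 γ hγ)).2 i hi
  have hUfin : FiniteDimensional K U := (basisRestrictSupport K _).finiteDimensional_of_finite
  have hUrank : Module.finrank K U = p ^ ∑ i ∈ Sᶜ, k i := by
    rw [Module.finrank_eq_card_basis (basisRestrictSupport K (E : Set (Fin n →₀ ℕ))),
      ← Finset.prod_pow_eq_pow_sum, ← card_boundedExponents]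
    exact Fintype.card_coe E
  refine ⟨S, k, LinearMap.range (φ.domRestrict U), inferInstance, ?_, ?_⟩
  · rw [LinearMap.finrank_range_of_inj hinj, hUrank]
  · intro B x hx hsum
    have hx' : ∀ g, ∃ f : MvPolynomial (Fin n) K, g ∈ B → f ∈ U ∧ φ f = x g := by
      intro g
      by_cases hg : g ∈ B
      · obtain ⟨f, hf⟩ := hx g hg
        exact ⟨f.1, fun _ => ⟨f.2, hf⟩⟩
      · exact ⟨0, fun h => absurd h hg⟩
    choose f hf using hx'
    -- Collect the terms with the same `∂` part: freeness of the `∂ ^ [p ^ k β]` on `P_n v` then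
    -- gives `y β ∈ I` for each `β`, and `hzero` gives `y β = 0`.
    let y : (Fin n →₀ ℕ) → MvPolynomial (Fin n) K := fun β =>
      ∑ g ∈ B with g.filter (· ∉ S) = β, monomial (g.filter (· ∈ S)) 1 * f g
    have hsum' : ∑ β ∈ B.image (fun g => g.filter (· ∉ S)),
        derOp K (scale (fun i => p ^ k i) β) • φ (y β) = 0 := by
      rw [← hsum, ← Finset.sum_fiberwise_of_maps_to (s := B) (g := fun g => g.filter (· ∉ S))
        (t := B.image (fun g => g.filter (· ∉ S))) (fun g hg => Finset.mem_image_of_mem _ hg)]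
      refine Finset.sum_congr rfl fun β _ => ?_
      rw [map_sum, Finset.smul_sum]
      refine Finset.sum_congr rfl fun g hg => ?_
      rw [Finset.mem_filter] at hg
      rw [← (hf g hg.1).2, hφ, hφ, mixedOp_smul_polyOp_smul, hg.2]
    have hy := eq_zero_of_sum_derOp_smul_eq_zero (fun i => p ^ k i) (LinearMap.range φ)
      (by
        rintro h _ ⟨g, rfl⟩
        exact ⟨h * g, (hact h g).symm⟩) Sᶜ
      (by
        intro i hi
        rw [Finset.mem_compl] at hi
        obtain ⟨h1, h2, h3, -⟩ := hG i hi
        refine ⟨Nat.pow_pos hp.pos, _, aeval_X_mem_supported Set.Iio_subset_Iic_self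
          Set.self_mem_Iic (G i), fun a => ?_, fun a ha => ?_, ?_, ?_⟩
        · rw [divDer_single_aeval Set.self_notMem_Iio]
          exact aeval_X_mem_supported Set.Iio_subset_Iic_self Set.self_mem_Iic _
        · rw [divDer_single_aeval Set.self_notMem_Iio,
            hasseDeriv_eq_zero_of_not_dvd (K := K) hp h1 ha, map_zero]
        · rintro _ ⟨g, rfl⟩
          rw [hact, hφ0]
          exact I.mul_mem_right _ h2
        · rintro _ ⟨g, rfl⟩ h0
          rw [hact, hφ0, divDer_single_aeval Set.self_notMem_Iio] at h0
          exact (hφ0 g).mpr ((hI.mem_or_mem h0).resolve_left h3))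
      _ (B.image (fun g => g.filter (· ∉ S))) id (Set.injOn_id _)
      (by
        intro β hβ i hi
        obtain ⟨g, -, rfl⟩ := Finset.mem_image.mp hβ
        rw [id, Finsupp.support_filter, Finset.mem_filter] at hi
        exact Finset.mem_compl.mpr hi.2)
      (fun β => φ (y β)) (fun β _ => ⟨_, rfl⟩) hsum'
    intro g hg
    -- an exponent is determined by its product with a bounded monomial
    have hdecomp : ∀ h ∈ B, h.filter (· ∉ S) = g.filter (· ∉ S) →
        ∀ δ ∈ E, ∀ ε ∈ E, h.filter (· ∈ S) + δ = g.filter (· ∈ S) + ε → h = g := by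
      intro h _ hhg δ hδ ε hε heq
      ext i
      by_cases hi : i ∈ S
      · have := DFunLike.congr_fun heq i
        rw [Finsupp.add_apply, Finsupp.add_apply, Finsupp.filter_apply_pos (· ∈ S) _ hi,
          Finsupp.filter_apply_pos (· ∈ S) _ hi, (mem_boundedExponents.mp hδ).1 i hi,
          (mem_boundedExponents.mp hε).1 i hi] at this
        exact this
      · have := DFunLike.congr_fun hhg i
        rwa [Finsupp.filter_apply_pos (· ∉ S) _ hi, Finsupp.filter_apply_pos (· ∉ S) _ hi] at this
    have hsupp : ∀ h ∈ B, ∀ δ ∈ (monomial (h.filter (· ∈ S)) 1 * f h).support,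
        ∃ ε ∈ E, δ = h.filter (· ∈ S) + ε := by
      intro h hh δ hδ
      rw [mem_support_iff, coeff_monomial_mul'] at hδ
      split_ifs at hδ with hle
      · rw [one_mul, ← mem_support_iff] at hδ
        exact ⟨_, hUE _ (hf h hh).1 _ hδ, (add_tsub_cancel_of_le hle).symm⟩
      · exact absurd rfl hδ
    have hy0 : y (g.filter (· ∉ S)) = 0 := by
      refine hzero _ (fun γ hγ i hi => ?_)
        ((hφ0 _).mp (hy _ (Finset.mem_image_of_mem _ hg)))
      obtain ⟨h, hh, hγ⟩ := Finset.mem_biUnion.mp (support_sum hγ)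
      rw [Finset.mem_filter] at hh
      obtain ⟨ε, hε, rfl⟩ := hsupp h hh.1 γ hγ
      rw [Finsupp.add_apply, Finsupp.filter_apply_neg (· ∈ S) _ hi, zero_add]
      exact (mem_boundedExponents.mp hε).2 i hi
    -- The exponents of each `f h` vanish on `S`, so among the terms of `y` only `h = g` contributes
    -- to this coefficient.
    have hfg : f g = 0 := by
      ext ε
      rw [coeff_zero]
      by_contra hne
      have hε : ε ∈ E := hUE _ (hf g hg).1 _ (mem_support_iff.mpr hne)
      have h1 := congrArg (coeff (g.filter (· ∈ S) + ε)) hy0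
      rw [coeff_zero, coeff_sum, Finset.sum_eq_single g, coeff_monomial_mul, one_mul] at h1
      · exact hne h1
      · intro h hh hhg
        rw [Finset.mem_filter] at hh
        by_contra hc
        obtain ⟨δ, hδ, heq⟩ := hsupp h hh.1 _ (mem_support_iff.mpr hc)
        exact hhg (hdecomp h hh.1 hh.2 δ hδ ε hε heq.symm)
      · intro h
        rw [Finset.mem_filter] at h
        exact absurd ⟨hg, rfl⟩ h
    rw [← (hf g hg).2, hfg, map_zero]

end Family

/-! ### Consequences of a freely acting family of operators -/

section General

variable {K : Type u} {A : Type v} [Field K] [Ring A] [Algebra K A] {M : Type w} [AddCommGroup M]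
  [Module K M] [Module A M]

theorem smul_mem_actSpan {U : Submodule K A} {V : Submodule K M} {a : A} {x : M} (ha : a ∈ U)
    (hx : x ∈ V) : a • x ∈ actSpan U V :=
  Submodule.subset_span ⟨a, ha, x, hx, rfl⟩

theorem actSpan_mono {U U' : Submodule K A} {V V' : Submodule K M} (hU : U ≤ U') (hV : V ≤ V') :
    actSpan U V ≤ actSpan U' V' :=
  Submodule.span_mono (Set.image2_subset hU hV)

variable [IsScalarTower K A M]

theorem actSpan_finiteDimensional (U : Submodule K A) (V : Submodule K M)
    [hU : FiniteDimensional K U] [hV : FiniteDimensional K V] :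
    FiniteDimensional K (actSpan U V) := by
  have h : actSpan U V = Submodule.map₂ (Algebra.lsmul K K M).toLinearMap U V := by
    rw [Submodule.map₂_eq_span_image2]
    rfl
  rw [h]
  exact Module.Finite.iff_fg.mpr (Submodule.FG.map₂ _ (Module.Finite.iff_fg.mp hU)
    (Module.Finite.iff_fg.mp hV))

/-- If a subalgebra is spanned by operators acting freely on `V`, it acts freely on `V`. -/
theorem actsFreely_of_family (B : Subalgebra K A) (V : Submodule K M) {ι : Type*} (b : ι → A)
    (hb : Subalgebra.toSubmodule B = Submodule.span K (Set.range b))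
    (hfree : ∀ (G : Finset ι) (x : ι → M), (∀ g ∈ G, x g ∈ V) →
      ∑ g ∈ G, b g • x g = 0 → ∀ g ∈ G, x g = 0) : ActsFreely B V := by
  classical
  have hbB : ∀ g, b g ∈ B := fun g => by
    rw [← Subalgebra.mem_toSubmodule, hb]
    exact Submodule.subset_span ⟨g, rfl⟩
  let μ : TensorProduct K B V →ₗ[B] M :=
    TensorProduct.AlgebraTensorModule.lift (LinearMap.toSpanSingleton B (V →ₗ[K] M) V.subtype)
  have hμ : ∀ (a : B) (x : V), μ (TensorProduct.tmul K a x) = (a : A) • (x : M) :=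
    fun _ _ => rfl
  -- every tensor is a combination of the `b g ⊗ v`
  have hrep : ∀ t : TensorProduct K B V, ∃ f : ι →₀ V,
      t = f.sum fun g x => TensorProduct.tmul K (⟨b g, hbB g⟩ : B) x := by
    let Ψ : (ι →₀ V) →ₗ[K] TensorProduct K B V :=
      Finsupp.lsum K fun g => TensorProduct.mk K B V ⟨b g, hbB g⟩
    have hΨ : ∀ f, Ψ f = f.sum fun g x => TensorProduct.tmul K (⟨b g, hbB g⟩ : B) x :=
      fun _ => rfl
    suffices h : ∀ t, t ∈ LinearMap.range Ψ by
      intro t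
      obtain ⟨f, hf⟩ := h t
      exact ⟨f, by rw [← hf, hΨ]⟩
    intro t
    induction t using TensorProduct.induction_on with
    | zero => exact zero_mem _
    | add s t hs ht => exact add_mem hs ht
    | tmul a x =>
      have ha : (a : A) ∈ Submodule.span K (Set.range b) := by
        rw [← hb]
        exact a.2
      obtain ⟨c, hc⟩ := Finsupp.mem_span_range_iff_exists_finsupp.mp ha
      have ha' : a = ∑ g ∈ c.support, c g • (⟨b g, hbB g⟩ : B) := by
        apply Subtype.ext
        rw [AddSubmonoidClass.coe_finsetSum, ← hc]
        rfl
      rw [ha', TensorProduct.sum_tmul]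
      refine Submodule.sum_mem _ fun g _ => ?_
      rw [← TensorProduct.smul_tmul']
      refine Submodule.smul_mem _ _ ⟨Finsupp.single g x, ?_⟩
      rw [hΨ]
      exact Finsupp.sum_single_index (TensorProduct.tmul_zero _ _)
  have hinj : Function.Injective μ := by
    rw [← LinearMap.ker_eq_bot, LinearMap.ker_eq_bot']
    intro t ht
    obtain ⟨f, rfl⟩ := hrep t
    rw [Finsupp.sum, map_sum] at ht
    have h0 := hfree f.support (fun g => (f g : M)) (fun g _ => (f g).2) ht
    refine Finset.sum_eq_zero fun g hg => ?_
    change TensorProduct.tmul K _ (f g) = 0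
    rw [show f g = 0 from Subtype.ext (h0 g hg), TensorProduct.tmul_zero]
  have hrange : LinearMap.range μ = Submodule.span B (V : Set M) := by
    apply le_antisymm
    · rintro _ ⟨t, rfl⟩
      induction t using TensorProduct.induction_on with
      | zero => rw [map_zero]; exact zero_mem _
      | add s t hs ht => rw [map_add]; exact add_mem hs ht
      | tmul a x => exact Submodule.smul_mem _ a (Submodule.subset_span x.2)
    · rw [Submodule.span_le]
      intro x hx
      refine ⟨TensorProduct.tmul K 1 ⟨x, hx⟩, ?_⟩
      rw [hμ, OneMemClass.coe_one, one_smul]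
  refine ⟨(LinearEquiv.ofInjective μ hinj).trans (LinearEquiv.ofEq _ _ hrange), fun a x => ?_⟩
  exact hμ a x

/-- Operators `b g ∈ U`, `g ∈ G`, acting freely on `V` give `|G| dim V ≤ dim U V`. -/
theorem card_mul_finrank_le (U : Submodule K A) (V : Submodule K M)
    [FiniteDimensional K U] [FiniteDimensional K V] {ι : Type*} (b : ι → A)
    (hfree : ∀ (G : Finset ι) (x : ι → M), (∀ g ∈ G, x g ∈ V) →
      ∑ g ∈ G, b g • x g = 0 → ∀ g ∈ G, x g = 0) (G : Finset ι) (hG : ∀ g ∈ G, b g ∈ U) :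
    G.card * Module.finrank K V ≤ Module.finrank K (actSpan U V) := by
  classical
  have := actSpan_finiteDimensional U V
  let Φ : (G → V) →ₗ[K] M :=
    ∑ g : G, (DistribSMul.toLinearMap K M (b g)) ∘ₗ V.subtype ∘ₗ LinearMap.proj g
  have hΦ : ∀ x, Φ x = ∑ g : G, b g • (x g : M) := fun x => by
    rw [LinearMap.sum_apply]
    rfl
  have hmem : ∀ x, Φ x ∈ actSpan U V := fun x => by
    rw [hΦ]
    exact Submodule.sum_mem _ fun g _ => smul_mem_actSpan (hG g g.2) (x g).2
  have hinj : Function.Injective (Φ.codRestrict _ hmem) := by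
    rw [← LinearMap.ker_eq_bot, LinearMap.ker_eq_bot']
    intro x hx
    have hx0 : Φ x = 0 := congrArg Subtype.val hx
    rw [hΦ, Finset.univ_eq_attach] at hx0
    have h0 := hfree G (fun g => if hg : g ∈ G then (x ⟨g, hg⟩ : M) else 0)
      (fun g hg => by rw [dif_pos hg]; exact (x _).2) (by
        rw [← hx0, ← Finset.sum_attach]
        exact Finset.sum_congr rfl fun g _ => by rw [dif_pos g.2])
    funext g
    have := h0 g g.2
    rw [dif_pos g.2] at this
    exact Subtype.ext this
  have h := LinearMap.finrank_le_finrank_of_injective hinj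
  rwa [Module.finrank_pi_fintype, Finset.sum_const, Finset.card_univ, Fintype.card_coe,
    smul_eq_mul] at h

end General

/-! ### Monomial spanning sets of the subalgebras `Λ_{S,k}` -/

section Spanning

open MvPolynomial

variable {K : Type u} [Field K] {n : ℕ}

theorem scale_add (m : Fin n → ℕ) (γ δ : Fin n →₀ ℕ) :
    scale m (γ + δ) = scale m γ + scale m δ := by
  ext i
  simp [add_mul]

theorem scale_single (m : Fin n → ℕ) (i : Fin n) (b : ℕ) :
    scale m (Finsupp.single i b) = Finsupp.single i (b * m i) := by
  ext j
  by_cases hj : i = j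
  · subst hj
    simp
  · simp [hj]

theorem scale_zero (m : Fin n → ℕ) : scale m 0 = 0 := by
  ext i
  simp

/-- The inner factors have disjoint variables and commute; a product of divided powers is a,
possibly zero, multiple of a divided power. -/
theorem mixedOp_mul (S : Finset (Fin n)) (m : Fin n → ℕ) (γ δ : Fin n →₀ ℕ) :
    ∃ c : K, mixedOp K S m γ * mixedOp K S m δ = c • mixedOp K S m (γ + δ) := by
  have hc := derOp_commute_polyOp (s := (S : Set (Fin n))) (β := scale m (γ.filter (· ∉ S)))
    (f := monomial (δ.filter (· ∈ S)) (1 : K))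
    (fun i hi => by
      have h := support_scale_subset _ _ hi
      rw [Finsupp.support_filter, Finset.mem_filter] at h
      exact h.2)
    (monomial_mem_supported (fun i hi => by
      rw [Finsupp.support_filter, Finset.mem_filter] at hi
      exact hi.2) 1)
  obtain ⟨c, hd⟩ : ∃ c : K, derOp K (scale m (γ.filter (· ∉ S))) *
      derOp K (scale m (δ.filter (· ∉ S))) = c • derOp K (scale m (γ.filter (· ∉ S)) +
        scale m (δ.filter (· ∉ S))) := ⟨_, derOp_mul _ _⟩
  refine ⟨c, ?_⟩
  rw [mixedOp, mixedOp, mul_assoc, ← mul_assoc (derOp K _), hc, mul_assoc, hd, mixedOp,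
    Finsupp.filter_add, Finsupp.filter_add, scale_add, mul_smul_comm, mul_smul_comm, ← mul_assoc,
    ← map_mul, monomial_mul, one_mul]

theorem mixedOp_single_mem {S : Finset (Fin n)} (m : Fin n → ℕ) {i : Fin n} (hi : i ∈ S) :
    mixedOp K S m (Finsupp.single i 1) = xOp K n i := by
  rw [mixedOp, Finsupp.filter_single_of_pos (· ∈ S) hi,
    Finsupp.filter_single_of_neg (· ∉ S) (not_not.mpr hi), scale_zero, derOp_zero, mul_one]
  exact polyOp_X i

theorem mixedOp_single_notMem {S : Finset (Fin n)} (m : Fin n → ℕ) {i : Fin n} (hi : i ∉ S)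
    (j : ℕ) : mixedOp K S m (Finsupp.single i j) = dOp K n i (j * m i) := by
  rw [mixedOp, Finsupp.filter_single_of_neg (· ∈ S) hi,
    Finsupp.filter_single_of_pos (· ∉ S) hi, scale_single, derOp_single]
  rw [show (monomial (0 : Fin n →₀ ℕ) (1 : K)) = 1 from rfl, map_one, one_mul]

theorem mixedOp_zero (S : Finset (Fin n)) (m : Fin n → ℕ) : mixedOp K S m 0 = 1 := by
  rw [mixedOp, Finsupp.filter_zero, Finsupp.filter_zero, scale_zero, derOp_zero, mul_one,
    show (monomial (0 : Fin n →₀ ℕ) (1 : K)) = 1 from rfl, map_one]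

/-- By `mixedOp_mul` the span is closed under products, and it contains the generators; conversely
each mixed operator is a product of generators. -/
theorem typeSubalgebra_eq_span (p : ℕ) (S : Finset (Fin n)) (k : Fin n → ℕ) :
    Subalgebra.toSubmodule (typeSubalgebra K n p S k) =
      Submodule.span K (Set.range (mixedOp K S fun i => p ^ k i)) := by
  apply le_antisymm
  · intro T hT
    rw [Subalgebra.mem_toSubmodule, typeSubalgebra] at hT
    induction hT using Algebra.adjoin_induction with
    | mem T hT =>
      rcases hT with ⟨i, hi, rfl⟩ | ⟨i, hi, j, rfl⟩
      · rw [← mixedOp_single_mem (fun i => p ^ k i) hi]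
        exact Submodule.subset_span ⟨_, rfl⟩
      · rw [← mixedOp_single_notMem (fun i => p ^ k i) hi]
        exact Submodule.subset_span ⟨_, rfl⟩
    | algebraMap c =>
      rw [Algebra.algebraMap_eq_smul_one, ← mixedOp_zero S fun i => p ^ k i]
      exact Submodule.smul_mem _ _ (Submodule.subset_span ⟨_, rfl⟩)
    | add T T' _ _ hT hT' => exact add_mem hT hT'
    | mul T T' _ _ hT hT' =>
      have h := Submodule.mul_mem_mul hT hT'
      rw [Submodule.span_mul_span] at h
      refine Submodule.span_le.mpr ?_ h
      rintro _ ⟨_, ⟨γ, rfl⟩, _, ⟨δ, rfl⟩, rfl⟩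
      obtain ⟨c, hc⟩ := mixedOp_mul (K := K) S (fun i => p ^ k i) γ δ
      change mixedOp K S _ γ * mixedOp K S _ δ ∈ _
      rw [hc]
      exact Submodule.smul_mem _ _ (Submodule.subset_span ⟨_, rfl⟩)
  · rw [Submodule.span_le]
    rintro _ ⟨γ, rfl⟩
    rw [SetLike.mem_coe, Subalgebra.mem_toSubmodule]
    refine mul_mem ?_ ?_
    · rw [← Subalgebra.mem_comap, monomial_eq, C_1, one_mul]
      refine prod_mem fun i hi => pow_mem ?_ _
      rw [Finsupp.support_filter, Finset.mem_filter] at hi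
      rw [Subalgebra.mem_comap]
      exact Algebra.subset_adjoin (Or.inl ⟨i, hi.2, polyOp_X i⟩)
    · have hsupp : ∀ i ∈ (γ.filter (· ∉ S)).support, i ∉ S := fun i hi => by
        rw [Finsupp.support_filter, Finset.mem_filter] at hi
        exact hi.2
      generalize γ.filter (· ∉ S) = β at hsupp
      induction β using Finsupp.induction with
      | zero => rw [scale_zero, derOp_zero]; exact one_mem _
      | single_add i b β hi hb ih =>
        have hsupp' : (Finsupp.single i b + β).support = insert i β.support := by
          ext j
          by_cases hj : i = j
          · subst hj
            simp [hb]
          · simp [Ne.symm hj]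
        rw [hsupp'] at hsupp
        rw [scale_add, scale_single, derOp_single_add _ _ _
          fun h => hi (support_scale_subset _ _ h)]
        refine mul_mem (Algebra.subset_adjoin (Or.inr ⟨i, hsupp i (Finset.mem_insert_self _ _),
          b, derOp_single _ _⟩)) (ih fun j hj => hsupp j (Finset.mem_insert_of_mem hj))

theorem typeSubalgebra_le_signSubalgebra (p : ℕ) (S : Finset (Fin n)) (k : Fin n → ℕ) :
    typeSubalgebra K n p S k ≤ signSubalgebra K n fun i => if i ∈ S then 1 else -1 := by
  refine Algebra.adjoin_mono ?_
  rintro T (⟨i, hi, rfl⟩ | ⟨i, hi, j, rfl⟩)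
  · exact Or.inl ⟨i, if_pos hi, rfl⟩
  · exact Or.inr ⟨i, if_neg hi, _, rfl⟩

theorem mixedOp_mem_canonicalFiltration (S : Finset (Fin n)) (m : Fin n → ℕ) (γ : Fin n →₀ ℕ)
    {N : ℕ} (h : (γ.filter (· ∈ S)).degree + (scale m (γ.filter (· ∉ S))).degree ≤ N) :
    mixedOp K S m γ ∈ (canonicalFiltration K n).term N :=
  mem_canonicalSpan _ _ h

end Spanning

/-! ### Counting exponents -/

section Counting

variable {n : ℕ}

variable (n) in
/-- The exponents of degree at most `N`. -/
noncomputable def degreeLE (N : ℕ) : Finset (Fin n →₀ ℕ) :=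
  (Finsupp.finite_of_degree_le (σ := Fin n) N).toFinset

theorem mem_degreeLE {N : ℕ} {γ : Fin n →₀ ℕ} : γ ∈ degreeLE n N ↔ γ.degree ≤ N :=
  Set.Finite.mem_toFinset _

theorem degree_eq_sum (γ : Fin n →₀ ℕ) : γ.degree = ∑ i, γ i := by
  rw [Finsupp.degree_eq_sum]

theorem card_degreeLE_le (N : ℕ) : (degreeLE n N).card ≤ (N + 1) ^ n := by
  have h : ((Fintype.piFinset fun _ : Fin n => Finset.range (N + 1)).card) = (N + 1) ^ n := by
    rw [Fintype.card_piFinset]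
    simp
  rw [← h]
  refine Finset.card_le_card_of_injOn (fun γ => ⇑γ) ?_ DFunLike.coe_injective.injOn
  intro γ hγ
  rw [Finset.mem_coe, mem_degreeLE, degree_eq_sum] at hγ
  rw [Finset.mem_coe, Fintype.mem_piFinset]
  intro i
  rw [Finset.mem_range, Nat.lt_succ_iff]
  exact (Finset.single_le_sum (f := fun i => γ i) (fun _ _ => Nat.zero_le _)
    (Finset.mem_univ i)).trans hγ

/-- A slack variable `none` turns the inequality `|γ| ≤ N` into an equality, counted by stars and
bars. -/
theorem choose_le_card_degreeLE (N : ℕ) : (N + n).choose n ≤ (degreeLE n N).card := by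
  classical
  have h := Finset.card_finsuppAntidiag_nat_eq_choose (s := (Finset.univ : Finset (Option (Fin n)))) N
  rw [Finset.card_univ, Fintype.card_option, Fintype.card_fin,
    show n + 1 + N - 1 = N + n by omega] at h
  have h' := Nat.choose_symm_add (a := N) (b := n)
  rw [← h', ← h]
  have hsum : ∀ f ∈ (Finset.univ : Finset (Option (Fin n))).finsuppAntidiag N,
      f none + ∑ i, f (some i) = N := by
    intro f hf
    rw [← Fintype.sum_option (f := fun o => f o)]
    exact (Finset.mem_finsuppAntidiag.mp hf).1
  refine Finset.card_le_card_of_injOn Finsupp.some ?_ ?_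
  · intro f hf
    rw [Finset.mem_coe, mem_degreeLE, degree_eq_sum]
    have := hsum f hf
    simp only [Finsupp.some_apply]
    omega
  · intro f hf g hg hfg
    have hs : ∀ i, f (some i) = g (some i) := fun i => DFunLike.congr_fun hfg i
    have h1 := hsum f hf
    have h2 := hsum g hg
    simp only [hs] at h1
    ext o
    cases o with
    | none => omega
    | some i => exact hs i

theorem pow_le_factorial_mul_card_degreeLE (N : ℕ) :
    N ^ n ≤ n.factorial * (degreeLE n N).card := by
  have h := Nat.pow_le_choose (α := ℚ) n (N + n)
  rw [div_le_iff₀ (by positivity), show N + n + 1 - n = N + 1 by omega] at h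
  have h' : (N + 1) ^ n ≤ (N + n).choose n * n.factorial := by exact_mod_cast h
  calc N ^ n ≤ (N + 1) ^ n := Nat.pow_le_pow_left (Nat.le_succ N) n
    _ ≤ _ := h'
    _ ≤ _ := by
      rw [mul_comm]
      exact Nat.mul_le_mul_left _ (choose_le_card_degreeLE N)

/-- The exponents `γ` for which `x ^ α ∂ ^ [m β]`, with `α`, `β` the parts of `γ` in and off `S`,
has degree at most `N`. -/
noncomputable def mixedDegreeLE (S : Finset (Fin n)) (m : Fin n → ℕ) (N : ℕ) :
    Finset (Fin n →₀ ℕ) := by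
  classical
  -- Starting from `degreeLE` provides finiteness; it excludes nothing when all `m i` are positive.
  exact (degreeLE n N).filter fun γ =>
    (γ.filter (· ∈ S)).degree + (scale m (γ.filter (· ∉ S))).degree ≤ N

theorem mixed_degree_eq (S : Finset (Fin n)) (m : Fin n → ℕ) (γ : Fin n →₀ ℕ) :
    (γ.filter (· ∈ S)).degree + (scale m (γ.filter (· ∉ S))).degree =
      ∑ i, γ i * (if i ∈ S then 1 else m i) := by
  rw [degree_eq_sum, degree_eq_sum, ← Finset.sum_add_distrib]
  refine Finset.sum_congr rfl fun i _ => ?_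
  rw [scale_apply]
  by_cases hi : i ∈ S
  · rw [Finsupp.filter_apply_pos (· ∈ S) _ hi, Finsupp.filter_apply_neg (· ∉ S) _ (not_not.mpr hi),
      if_pos hi]
    omega
  · rw [Finsupp.filter_apply_neg (· ∈ S) _ hi, Finsupp.filter_apply_pos (· ∉ S) _ hi,
      if_neg hi, zero_add]

/-- Division with remainder by `m i` off `S`: the quotients satisfy the weighted bound and the
remainders fill a box of `∏ m i` points. -/
theorem card_degreeLE_le_mul (S : Finset (Fin n)) (m : Fin n → ℕ) (hm : ∀ i, 0 < m i) (N : ℕ) :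
    (degreeLE n N).card ≤ (mixedDegreeLE S m N).card * ∏ i ∈ Sᶜ, m i := by
  classical
  let m' : Fin n → ℕ := fun i => if i ∈ S then 1 else m i
  have hm' : ∀ i, 0 < m' i := fun i => by
    simp only [m']
    split_ifs
    · exact Nat.one_pos
    · exact hm i
  rw [← card_boundedExponents, ← Finset.card_product]
  refine Finset.card_le_card_of_injOn (fun γ =>
    (Finsupp.equivFunOnFinite.symm fun i => γ i / m' i,
      Finsupp.equivFunOnFinite.symm fun i => γ i % m' i)) ?_ ?_
  · intro γ hγ
    rw [Finset.mem_coe, mem_degreeLE, degree_eq_sum] at hγ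
    rw [Finset.mem_coe, Finset.mem_product]
    constructor
    · rw [mixedDegreeLE, Finset.mem_filter, mem_degreeLE, mixed_degree_eq, degree_eq_sum]
      exact ⟨(Finset.sum_le_sum fun i _ => Nat.div_le_self _ _).trans hγ,
        (Finset.sum_le_sum fun i _ => Nat.div_mul_le_self _ _).trans hγ⟩
    · rw [mem_boundedExponents]
      refine ⟨fun i hi => ?_, fun i hi => ?_⟩
      · change γ i % (if i ∈ S then 1 else m i) = 0
        rw [if_pos hi, Nat.mod_one]
      · change γ i % (if i ∈ S then 1 else m i) < m i
        rw [if_neg hi]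
        exact Nat.mod_lt _ (hm i)
  · intro γ _ δ _ h
    ext i
    have h1 : γ i / m' i = δ i / m' i := DFunLike.congr_fun (Prod.ext_iff.mp h).1 i
    have h2 : γ i % m' i = δ i % m' i := DFunLike.congr_fun (Prod.ext_iff.mp h).2 i
    rw [← Nat.div_add_mod (γ i) (m' i), h1, h2, Nat.div_add_mod]

end Counting

/-! ### Estimates for the degree of growth -/

section Growth

open Filter

/-- Comparison of powers: `i ^ s ≤ C i ^ r` for all large `i` only if `s ≤ r`. -/
theorem le_of_eventually_rpow_le {r s C : ℝ}
    (h : ∀ᶠ i : ℕ in atTop, (i : ℝ) ^ s ≤ C * (i : ℝ) ^ r) : s ≤ r := by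
  by_contra hlt
  have ht : Tendsto (fun i : ℕ => (i : ℝ) ^ (s - r)) atTop atTop :=
    (tendsto_rpow_atTop (by linarith)).comp tendsto_natCast_atTop_atTop
  obtain ⟨i, h1, h2, h3⟩ := (h.and ((ht.eventually_gt_atTop C).and (eventually_gt_atTop 0))).exists
  have hi : (0 : ℝ) < i := by exact_mod_cast h3
  rw [Real.rpow_sub hi, lt_div_iff₀ (Real.rpow_pos_of_pos hi r)] at h2
  linarith

/-- Any exponent `r > n` eventually absorbs the constant `C`, so the infimum is at most `n`. -/
theorem growthDegree_le {f : ℕ → ℕ} {n C : ℕ} (h : ∀ i, 0 < i → f i ≤ C * i ^ n) :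
    growthDegree f ≤ ((n : ℝ) : EReal) := by
  rw [← EReal.le_of_forall_lt_iff_le]
  intro r hr
  have hr : (n : ℝ) < r := by exact_mod_cast hr
  refine sInf_le ⟨r, rfl, ?_⟩
  have ht : Tendsto (fun i : ℕ => (i : ℝ) ^ (r - n)) atTop atTop :=
    (tendsto_rpow_atTop (by linarith)).comp tendsto_natCast_atTop_atTop
  filter_upwards [ht.eventually_ge_atTop (C : ℝ), eventually_gt_atTop 0] with i h2 h3
  have hi : (0 : ℝ) < i := by exact_mod_cast h3
  rw [Real.rpow_sub hi, le_div_iff₀ (Real.rpow_pos_of_pos hi _), Real.rpow_natCast] at h2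
  calc (f i : ℝ) ≤ ((C * i ^ n : ℕ) : ℝ) := by exact_mod_cast h i h3
    _ = C * (i : ℝ) ^ n := by push_cast; rfl
    _ ≤ _ := h2

/-- The shift by `j` is harmless: `i ≤ 2 (i - j)` once `i ≥ 2 j`, at the cost of a factor `2 ^ n`.
-/
theorem le_growthDegree {f : ℕ → ℕ} {n C j : ℕ} (h : ∀ i, i ^ n ≤ C * f (i + j)) :
    ((n : ℝ) : EReal) ≤ growthDegree f := by
  refine le_sInf ?_
  rintro _ ⟨r, rfl, hr⟩
  rw [EReal.coe_le_coe_iff]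
  refine le_of_eventually_rpow_le (C := 2 ^ n * C) ?_
  filter_upwards [hr, eventually_ge_atTop (2 * j)] with i h1 h2
  have h3 : i ^ n ≤ 2 ^ n * (C * f i) := by
    have h4 := h (i - j)
    rw [Nat.sub_add_cancel (by omega)] at h4
    calc i ^ n ≤ (2 * (i - j)) ^ n := Nat.pow_le_pow_left (by omega) n
      _ = 2 ^ n * (i - j) ^ n := mul_pow _ _ _
      _ ≤ _ := Nat.mul_le_mul_left _ h4
  have h5 : (i : ℝ) ^ n ≤ 2 ^ n * (C * (f i : ℝ)) := by exact_mod_cast h3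
  rw [Real.rpow_natCast]
  calc (i : ℝ) ^ n ≤ 2 ^ n * C * (f i : ℝ) := by rw [mul_assoc]; exact h5
    _ ≤ _ := mul_le_mul_of_nonneg_left h1 (by positivity)

end Growth

/-! ### Finite dimensional subspaces and filtrations -/

section Filtration

variable {K : Type u} {A : Type v} [Field K] [Ring A] [Algebra K A] {M : Type w} [AddCommGroup M]
  [Module K M] [Module A M] [IsScalarTower K A M]

theorem FiniteFiltration.smul_mem_actSpan (F : FiniteFiltration K A) {M₀ : Submodule K M} {i j : ℕ}
    {a : A} (ha : a ∈ F.term i) {x : M} (hx : x ∈ actSpan (F.term j) M₀) :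
    a • x ∈ actSpan (F.term (i + j)) M₀ := by
  induction hx using Submodule.span_induction with
  | mem x hx =>
    obtain ⟨b, hb, y, hy, rfl⟩ := hx
    change a • b • y ∈ _
    rw [← mul_smul]
    exact HolSub.smul_mem_actSpan (F.mul_mem _ _ _ _ ha hb) hy
  | zero => rw [smul_zero]; exact zero_mem _
  | add x y _ _ hx hy => rw [smul_add]; exact add_mem hx hy
  | smul c x _ hx => rw [smul_algebra_smul_comm]; exact Submodule.smul_mem _ _ hx

/-- A finite dimensional subspace of `A M₀` lies in some `A_j M₀`. -/
theorem FiniteFiltration.exists_le_actSpan (F : FiniteFiltration K A) {M₀ : Submodule K M}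
    (hM₀ : Submodule.span A (M₀ : Set M) = ⊤) (V : Submodule K M) [hV : FiniteDimensional K V] :
    ∃ j, V ≤ actSpan (F.term j) M₀ := by
  have hmono : ∀ i j, i ≤ j → actSpan (F.term i) M₀ ≤ actSpan (F.term j) M₀ :=
    fun i j h => actSpan_mono (F.mono i j h) le_rfl
  have hex : ∀ x : M, ∃ j, x ∈ actSpan (F.term j) M₀ := by
    intro x
    have hx : x ∈ Submodule.span A (M₀ : Set M) := hM₀ ▸ Submodule.mem_top
    induction hx using Submodule.span_induction with
    | mem x hx =>
      refine ⟨0, ?_⟩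
      rw [← one_smul A x]
      exact HolSub.smul_mem_actSpan F.one_mem hx
    | zero => exact ⟨0, zero_mem _⟩
    | add x y _ _ hx hy =>
      obtain ⟨i, hi⟩ := hx
      obtain ⟨j, hj⟩ := hy
      exact ⟨max i j, add_mem (hmono _ _ (le_max_left i j) hi) (hmono _ _ (le_max_right i j) hj)⟩
    | smul a x _ hx =>
      obtain ⟨j, hj⟩ := hx
      obtain ⟨i, hi⟩ := F.exhaustive a
      exact ⟨i + j, F.smul_mem_actSpan hi hj⟩
  choose j hj using hex
  obtain ⟨s, hs⟩ := Module.Finite.iff_fg.mp hV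
  refine ⟨s.sup j, ?_⟩
  rw [← hs, Submodule.span_le]
  exact fun x hx => hmono _ _ (Finset.le_sup (f := j) hx) (hj x)

theorem FiniteFiltration.finiteDimensional_inf_term (F : FiniteFiltration K A)
    (U : Submodule K A) (i : ℕ) : FiniteDimensional K ↥(U ⊓ F.term i) := by
  have := F.finite i
  exact Submodule.finiteDimensional_inf_right _ _

end Filtration

/-! ### Growth of modules and the holonomic number of `D(P_n)` -/

section DiffOps

open MvPolynomial

variable {K : Type u} [Field K] {n : ℕ}

/-- Every nonzero `D(P_n)`-module contains a finite dimensional subspace on which a subalgebra of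
the given type acts freely, and with growth at least `i ^ n / n!`. -/
theorem exists_typeSubalgebra_actsFreely {p : ℕ} (hp : p.Prime) [CharP K p] (M : Type w)
    [AddCommGroup M] [Module K M] [Module (diffOps K n) M] [IsScalarTower K (diffOps K n) M]
    [Nontrivial M] :
    ∃ (S : Finset (Fin n)) (k : Fin n → ℕ) (V : Submodule K M), FiniteDimensional K V ∧
      p ^ (∑ i ∈ Sᶜ, k i) ≤ Module.finrank K V ∧
      ActsFreely (A := diffOps K n) (typeSubalgebra K n p S k) V ∧
      ∀ N, N ^ n ≤ n.factorial * Module.finrank K (actSpan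
        (Subalgebra.toSubmodule (typeSubalgebra K n p S k) ⊓ (canonicalFiltration K n).term N)
          V) := by
  obtain ⟨S, k, V, hV, hdim, hfree⟩ := exists_free_subspace (K := K) (n := n) (M := M) hp
  refine ⟨S, k, V, hV, hdim, actsFreely_of_family _ V _ (typeSubalgebra_eq_span p S k) hfree,
    fun N => ?_⟩
  have := (canonicalFiltration K n).finiteDimensional_inf_term
    (Subalgebra.toSubmodule (typeSubalgebra K n p S k)) N
  have h1 := card_mul_finrank_le (Subalgebra.toSubmodule (typeSubalgebra K n p S k) ⊓
    (canonicalFiltration K n).term N) V _ hfree (mixedDegreeLE S (fun i => p ^ k i) N)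
    (fun γ hγ => by
      refine Submodule.mem_inf.mpr ⟨?_, mixedOp_mem_canonicalFiltration _ _ _ ?_⟩
      · rw [typeSubalgebra_eq_span]
        exact Submodule.subset_span ⟨γ, rfl⟩
      · rw [mixedDegreeLE, Finset.mem_filter] at hγ
        exact hγ.2)
  -- The product of the `p ^ k i` lost in passing to weighted exponents is bounded by `dim V`, so
  -- the leading coefficient stays `1 / n!`.
  refine (pow_le_factorial_mul_card_degreeLE N).trans (Nat.mul_le_mul_left _ ?_)
  refine (card_degreeLE_le_mul S (fun i => p ^ k i) (fun i => Nat.pow_pos hp.pos) N).trans ?_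
  refine (Nat.mul_le_mul_left _ ?_).trans h1
  rw [Finset.prod_pow_eq_pow_sum]
  exact hdim

/-- If `V ⊆ A_j M₀`, then `(Λ ∩ A_i) V ⊆ A_{i + j} M₀`, so the growth of `Λ` on `V` bounds `Dim M`
from below. -/
theorem natCast_le_holonomicNumber {p : ℕ} (hp : p.Prime) [CharP K p] :
    ((n : ℝ) : EReal) ≤ holonomicNumber (canonicalFiltration K n) := by
  refine le_sInf ?_
  rintro _ ⟨M, _, _, _, _, M₀, _, hfin, hspan, rfl⟩
  obtain ⟨S, k, V, hV, -, -, hgrow⟩ := exists_typeSubalgebra_actsFreely (K := K) (n := n) hp M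
  obtain ⟨j, hj⟩ := (canonicalFiltration K n).exists_le_actSpan hspan V
  refine le_growthDegree (C := n.factorial) (j := j) fun i => (hgrow i).trans ?_
  refine Nat.mul_le_mul_left _ ?_
  have := (canonicalFiltration K n).finite (i + j)
  have := actSpan_finiteDimensional ((canonicalFiltration K n).term (i + j)) M₀
  refine Submodule.finrank_mono ?_
  refine Submodule.span_le.mpr ?_
  rintro _ ⟨a, ha, x, hx, rfl⟩
  exact (canonicalFiltration K n).smul_mem_actSpan (Submodule.mem_inf.mp ha).2 (hj hx)

theorem apply_one_mem_restrictSupport {N : ℕ} {T : Module.End K (MvPolynomial (Fin n) K)}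
    (hT : T ∈ canonicalSpan K n N) (c : K) :
    T (C c) ∈ restrictSupport K (degreeLE n N : Set (Fin n →₀ ℕ)) := by
  induction hT using Submodule.span_induction with
  | zero => exact zero_mem _
  | add S T _ _ hS hT => exact add_mem hS hT
  | smul c T _ hT => exact Submodule.smul_mem _ _ hT
  | mem T hT =>
    obtain ⟨α, β, hab, rfl⟩ := hT
    rw [Module.End.mul_apply, ← monomial_zero', divDer_monomial, mulMon_monomial, zero_tsub,
      add_zero, monomial_mem_restrictSupport]
    exact Or.inl (mem_degreeLE.mpr (by omega))

/-- The module `P_n` generated by `1` is the witness: `A_i` sends constants to polynomials of degree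
at most `i`, a space of dimension at most `(i + 1) ^ n ≤ 2 ^ n i ^ n`. -/
theorem holonomicNumber_le : holonomicNumber (canonicalFiltration K n) ≤ ((n : ℝ) : EReal) := by
  refine le_trans (b := dimWith (canonicalFiltration K n)
    (Submodule.span K {(1 : MvPolynomial (Fin n) K)})) (sInf_le ?_)
    (growthDegree_le (C := 2 ^ n) fun i hi => ?_)
  · refine ⟨MvPolynomial (Fin n) K, inferInstance, inferInstance, inferInstance,
      inferInstance, Submodule.span K {1}, inferInstance, inferInstance, ?_, rfl⟩
    rw [eq_top_iff]
    intro f _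
    have h : polyOp K n f • (1 : MvPolynomial (Fin n) K) = f := mul_one f
    rw [← h]
    exact Submodule.smul_mem _ _ (Submodule.subset_span (Submodule.mem_span_singleton_self 1))
  · have hfin : FiniteDimensional K
        (restrictSupport K (degreeLE n i : Set (Fin n →₀ ℕ))) :=
      (basisRestrictSupport K _).finiteDimensional_of_finite
    have hle : actSpan ((canonicalFiltration K n).term i)
        (Submodule.span K {(1 : MvPolynomial (Fin n) K)}) ≤
          restrictSupport K (degreeLE n i : Set (Fin n →₀ ℕ)) := by
      refine Submodule.span_le.mpr ?_
      rintro _ ⟨T, hT, x, hx, rfl⟩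
      obtain ⟨c, rfl⟩ := Submodule.mem_span_singleton.mp hx
      rw [smul_eq_C_mul, mul_one]
      exact apply_one_mem_restrictSupport hT c
    refine (Submodule.finrank_mono hle).trans ?_
    rw [Module.finrank_eq_card_basis (basisRestrictSupport K (degreeLE n i : Set (Fin n →₀ ℕ)))]
    refine (Fintype.card_coe (degreeLE n i)).le.trans ((card_degreeLE_le i).trans ?_)
    rw [← mul_pow]
    exact Nat.pow_le_pow_left (by omega) n

theorem holonomicNumber_canonicalFiltration {p : ℕ} (hp : p.Prime) [CharP K p] :
    holonomicNumber (canonicalFiltration K n) = ((n : ℝ) : EReal) :=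
  le_antisymm holonomicNumber_le (natCast_le_holonomicNumber hp)

/-- A set of subalgebras containing, up to enlargement, the subalgebras `Λ_{S,k}` is holonomic of
degree `n` with multiplicity `1`. -/
theorem isHolonomicSet_of_forall_exists_le {p : ℕ} (hp : p.Prime) [CharP K p] (hn : 0 < n)
    (𝒞 : Set (Subalgebra K (diffOps K n)))
    (h𝒞 : ∀ S k, ∃ B ∈ 𝒞, typeSubalgebra K n p S k ≤ B) :
    IsHolonomicSet.{u, u, w} (canonicalFiltration K n) 𝒞 n 1 := by
  refine ⟨⟨by exact_mod_cast hn, by positivity, ?_⟩, holonomicNumber_canonicalFiltration hp⟩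
  intro M _ _ _ _ _
  obtain ⟨S, k, V, hV, hdim, -, hgrow⟩ := exists_typeSubalgebra_actsFreely (K := K) (n := n) hp M
  obtain ⟨B, hB, hle⟩ := h𝒞 S k
  -- The lower bound holds for every `i`, so the error term is zero.
  refine ⟨V, ?_, hV, B, hB, fun _ => 0, Asymptotics.isLittleO_zero _ _,
    Filter.Eventually.of_forall fun i => ?_⟩
  · rintro rfl
    rw [finrank_bot] at hdim
    exact absurd hdim (not_le.mpr (Nat.pow_pos hp.pos))
  · have := (canonicalFiltration K n).finiteDimensional_inf_term (Subalgebra.toSubmodule B) i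
    have := actSpan_finiteDimensional
      (Subalgebra.toSubmodule B ⊓ (canonicalFiltration K n).term i) V
    have h1 := (hgrow i).trans (Nat.mul_le_mul_left _ (Submodule.finrank_mono (actSpan_mono
      (V' := V) (inf_le_inf_right ((canonicalFiltration K n).term i)
        (show Subalgebra.toSubmodule (typeSubalgebra K n p S k) ≤ Subalgebra.toSubmodule B
          from hle)) le_rfl)))
    rw [add_zero, Real.rpow_natCast, one_div, inv_mul_le_iff₀ (by positivity)]
    exact_mod_cast h1

end DiffOps

end HolSub

theorem mainTheorem9 (p : ℕ) (hp : p.Prime) (K : Type u) [Field K] [CharP K p] (n : ℕ) :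
    (0 < n →
      HolSub.IsHolonomicSet.{u, u, w} (HolSub.canonicalFiltration K n)
        (HolSub.typeSubalgebras K n p) n 1) ∧
    (0 < n →
      HolSub.IsHolonomicSet.{u, u, w} (HolSub.canonicalFiltration K n)
        (HolSub.signSubalgebras K n) n 1) ∧
    (∀ (M : Type w) [AddCommGroup M] [Module K M] [Module (HolSub.diffOps K n) M]
        [IsScalarTower K (HolSub.diffOps K n) M] [Nontrivial M],
      ∃ (S : Finset (Fin n)) (k : Fin n → ℕ) (V : Submodule K M),
        FiniteDimensional K V ∧
        p ^ (∑ i ∈ Sᶜ, k i) ≤ Module.finrank K V ∧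
        HolSub.ActsFreely (A := HolSub.diffOps K n) (HolSub.typeSubalgebra K n p S k) V) := by
  refine ⟨fun hn => HolSub.isHolonomicSet_of_forall_exists_le hp hn _
      fun S k => ⟨_, ⟨S, k, rfl⟩, le_rfl⟩,
    fun hn => HolSub.isHolonomicSet_of_forall_exists_le hp hn _
      fun S k => ⟨_, ⟨_, rfl⟩, HolSub.typeSubalgebra_le_signSubalgebra p S k⟩, ?_⟩
  intro M _ _ _ _ _
  obtain ⟨S, k, V, hV, hdim, hfree, -⟩ :=
    HolSub.exists_typeSubalgebra_actsFreely (K := K) (n := n) hp M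
  exact ⟨S, k, V, hV, hdim, hfree⟩
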